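/- For a compact set \(K\subset\mathbb{R}^2\) and a point \(x\in\mathbb{R}^2\), let \[K_x=\{u\in K : [x,u]\cap K=\{u\}\}\] be the part of \(K\) visible from \(x\), where \([x,u]\) denotes the closed line segment joining \(x\) to \(u\), and let \(\dim_H\) denote Hausdorff dimension. If \(\Gamma\subset\mathbb{R}^2\) is a compact connected set with \(\dim_H\Gamma>1\), then for Lebesgue-almost every \(x\in\mathbb{R}^2\), \[\dim_H(\Gamma_x)\le \frac12+\sqrt{\dim_H\Gamma-\frac34}.\] -/

import Mathlib

/-- The part of `K ⊆ ℝ²` visible from `x`: the points `u ∈ K` such that the closed line segment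
`[x, u]` meets `K` only at `u`. -/
def visiblePart (K : Set (EuclideanSpace ℝ (Fin 2))) (x : EuclideanSpace ℝ (Fin 2)) :
    Set (EuclideanSpace ℝ (Fin 2)) :=
  {u | u ∈ K ∧ segment ℝ x u ∩ K = {u}}

/-! Two viewpoints at distance `d` on a horizontal line below a piece of `Γ` order the sightlines
that they share by slope. Three sightlines whose two orders form the pattern `231`, together with
the segment joining the viewpoints, would separate two points of `Γ`, so connectedness makes the
pair of orders avoid that pattern. Hence at most about `1 / (r * d)` grid cubes of side `r` are
visible from both viewpoints. Integrating this over pairs of viewpoints bounds the sum over all grid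
cubes of the squared lengths of the sets of viewpoints seeing them by about `1 / r`.

A cover of `Γ` by cubes with `∑ r ^ σ` bounded, restricted to the cubes seen from `x`, therefore has
small expected value of `∑ r ^ t` as soon as `2 * t > σ + 1`: use `v ≤ r ^ α + r ^ (-α) * v ^ 2`
for the length `v` of each set of viewpoints. So the visible part has dimension at most
`(dimH Γ + 1) / 2` from almost every point off `Γ`, and `(s + 1) / 2 ≤ 1 / 2 + √(s - 3 / 4)` for
`1 ≤ s ≤ 2`.
-/

open MeasureTheory Set Filter
open scoped ENNReal Topology

local notation "ℝ²" => EuclideanSpace ℝ (Fin 2)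

section Counting

variable {α : Type*}

theorem card_le_of_forall_lt_add {F : Finset α} {f : α → ℤ} {g : ℕ} (hinj : InjOn f F)
    (h : ∀ p ∈ F, ∀ q ∈ F, f q < f p + g) : F.card ≤ g := by
  rcases F.eq_empty_or_nonempty with rfl | hF
  · exact Nat.zero_le g
  obtain ⟨p, hp, hmin⟩ := F.exists_min_image f hF
  have himage : F.image f ⊆ Finset.Ico (f p) (f p + g) :=
    Finset.image_subset_iff.2 fun q hq => Finset.mem_Ico.2 ⟨hmin q hq, h p hp q hq⟩
  calc F.card = (F.image f).card := (Finset.card_image_of_injOn hinj).symm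
    _ ≤ (Finset.Ico (f p) (f p + g)).card := Finset.card_le_card himage
    _ = g := by rw [Int.card_Ico, add_sub_cancel_left, Int.toNat_natCast]

theorem card_le_mul_card_image_of_forall_lt_add {β : Type*} [DecidableEq β] {F : Finset α}
    {key : α → β} {f : α → ℤ} {g : ℕ} (hinj : InjOn (fun p => (key p, f p)) F)
    (h : ∀ p ∈ F, ∀ q ∈ F, key p = key q → f q < f p + g) :
    F.card ≤ g * (F.image key).card := by
  refine Finset.card_le_mul_card_image F g fun b _ => card_le_of_forall_lt_add (f := f) ?_ ?_
  · intro p hp q hq hpq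
    obtain ⟨hpF, rfl⟩ := Finset.mem_filter.1 hp
    obtain ⟨hqF, hqp⟩ := Finset.mem_filter.1 hq
    exact hinj hpF hqF (Prod.ext hqp.symm hpq)
  · intro p hp q hq
    obtain ⟨hpF, rfl⟩ := Finset.mem_filter.1 hp
    obtain ⟨hqF, hqp⟩ := Finset.mem_filter.1 hq
    exact h p hpF q hqF hqp.symm

theorem card_le_mul_of_forall_lt_add {F : Finset (Fin 2 → ℤ)} {g₀ g₁ : ℕ}
    (h₀ : ∀ m ∈ F, ∀ m' ∈ F, m 1 = m' 1 → m' 0 < m 0 + g₀)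
    (h₁ : ∀ m ∈ F, ∀ m' ∈ F, m' 1 < m 1 + g₁) : F.card ≤ g₀ * g₁ := by
  have hrows : (F.image fun m => m 1).card ≤ g₁ := by
    refine card_le_of_forall_lt_add (f := id) Function.injective_id.injOn fun z hz z' hz' => ?_
    obtain ⟨m, hm, rfl⟩ := Finset.mem_image.1 hz
    obtain ⟨m', hm', rfl⟩ := Finset.mem_image.1 hz'
    exact h₁ m hm m' hm'
  refine (card_le_mul_card_image_of_forall_lt_add (key := fun m => m 1) (f := fun m => m 0)
    (fun m _ m' _ hmm => ?_) h₀).trans (Nat.mul_le_mul_left g₀ hrows)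
  obtain ⟨h1, h0⟩ := Prod.ext_iff.1 hmm
  exact funext (Fin.forall_fin_two.2 ⟨h0, h1⟩)

/-- `O` contains no three points `u`, `w`, `v` in this order from left to right whose heights are
ordered `v < u < w` (the permutation pattern 231), all six inequalities holding with a margin `g`
that absorbs discretization errors. -/
def AvoidsPattern231 (O : Finset (ℤ × ℤ)) (g : ℕ) : Prop :=
  ∀ u ∈ O, ∀ w ∈ O, ∀ v ∈ O,
    u.1 + g ≤ w.1 → w.1 + g ≤ v.1 → v.2 + g ≤ u.2 → ¬u.2 + g ≤ w.2

namespace AvoidsPattern231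

variable {O : Finset (ℤ × ℤ)} {g : ℕ}

/-- The points with no point of `O` far to their left in the same row are few in each row, and
those with no point of `O` far above them in the same column are few in each column. Any other
point of `O` plays the roles of both `u` and `w` for a point far down its antidiagonal. -/
theorem card_le (h : AvoidsPattern231 O g) :
    O.card ≤ g * ((O.image Prod.snd).card + (O.image Prod.fst).card +
      (O.image fun p => p.1 + p.2).card) := by
  classical
  set R := O.filter fun p => ∀ q ∈ O, q.2 = p.2 → p.1 < q.1 + g with hR
  set C := O.filter fun p => ∀ q ∈ O, q.1 = p.1 → q.2 < p.2 + g with hC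
  set D := O.filter fun p => (∃ q ∈ O, q.2 = p.2 ∧ q.1 + g ≤ p.1) ∧
    (∃ q ∈ O, q.1 = p.1 ∧ p.2 + g ≤ q.2) with hD
  have hcover : O ⊆ R ∪ C ∪ D := by
    intro p hp
    simp only [hR, hC, hD, Finset.mem_union, Finset.mem_filter]
    grind
  have cardR : R.card ≤ g * (O.image Prod.snd).card := by
    refine (card_le_mul_card_image_of_forall_lt_add (key := Prod.snd) (f := Prod.fst) ?_ ?_).trans
      (Nat.mul_le_mul_left g (Finset.card_le_card
        (Finset.image_subset_image (Finset.filter_subset _ _))))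
    · exact Prod.swap_injective.injOn
    · exact fun p hp q hq hpq => (Finset.mem_filter.1 hq).2 p (Finset.mem_filter.1 hp).1 hpq
  have cardC : C.card ≤ g * (O.image Prod.fst).card := by
    refine (card_le_mul_card_image_of_forall_lt_add (key := Prod.fst) (f := Prod.snd) ?_ ?_).trans
      (Nat.mul_le_mul_left g (Finset.card_le_card
        (Finset.image_subset_image (Finset.filter_subset _ _))))
    · exact Function.injective_id.injOn
    · exact fun p hp q hq hpq => (Finset.mem_filter.1 hp).2 q (Finset.mem_filter.1 hq).1 hpq.symm
  have cardD : D.card ≤ g * (O.image fun p => p.1 + p.2).card := by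
    refine (card_le_mul_card_image_of_forall_lt_add (key := fun p => p.1 + p.2) (f := Prod.fst)
      ?_ ?_).trans (Nat.mul_le_mul_left g (Finset.card_le_card
        (Finset.image_subset_image (Finset.filter_subset _ _))))
    · intro p _ q _ hpq
      obtain ⟨hsum, hfst⟩ := Prod.ext_iff.1 hpq
      exact Prod.ext hfst (by simpa [show p.1 = q.1 from hfst] using hsum)
    · intro p hp v hv hpv
      by_contra! hfar
      obtain ⟨-, ⟨u, hu, hu2, hu1⟩, ⟨w, hw, hw1, hw2⟩⟩ := Finset.mem_filter.1 hp
      exact h u hu w hw v (Finset.mem_filter.1 hv).1 (by omega) (by omega) (by omega) (by omega)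
  calc O.card ≤ R.card + C.card + D.card := (Finset.card_le_card hcover).trans
        ((Finset.card_union_le _ _).trans (Nat.add_le_add_right (Finset.card_union_le _ _) _))
    _ ≤ _ := by rw [mul_add, mul_add]; gcongr

theorem card_le_of_abs_le (h : AvoidsPattern231 O g) {n : ℕ}
    (hO : ∀ p ∈ O, |p.1| ≤ n ∧ |p.2| ≤ n) : O.card ≤ g * (8 * n + 3) := by
  have card_image_le {f : ℤ × ℤ → ℤ} {k : ℕ} (hf : ∀ p ∈ O, |f p| ≤ k) :
      (O.image f).card ≤ 2 * k + 1 := by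
    have hsub : O.image f ⊆ Finset.Icc (-k : ℤ) k :=
      Finset.image_subset_iff.2 fun p hp => Finset.mem_Icc.2 (abs_le.1 (hf p hp))
    have := Finset.card_le_card hsub
    rw [Int.card_Icc] at this
    omega
  have hsnd := card_image_le fun p hp => (hO p hp).2
  have hfst := card_image_le fun p hp => (hO p hp).1
  have hsum : (O.image fun p => p.1 + p.2).card ≤ 2 * (2 * n) + 1 :=
    card_image_le fun p hp => (abs_add_le _ _).trans (by push_cast; linarith [hO p hp])
  exact h.card_le.trans (Nat.mul_le_mul_left g (by omega))

end AvoidsPattern231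

end Counting

section Floor

variable {ε z z' w w' : ℝ}

theorem lt_of_floor_div_add_three_le (hε : 0 < ε) (hzw : |w - z| ≤ ε) (hzw' : |w' - z'| ≤ ε)
    (h : ⌊z / ε⌋ + 3 ≤ ⌊z' / ε⌋) : w < w' := by
  have hfloor : (⌊z / ε⌋ : ℝ) + 3 ≤ ⌊z' / ε⌋ := by exact_mod_cast h
  have hgap : z / ε + 2 < z' / ε := by
    linarith [Int.lt_floor_add_one (z / ε), Int.floor_le (z' / ε)]
  have hgap' : z + 2 * ε < z' := by
    rwa [lt_div_iff₀ hε, add_mul, div_mul_cancel₀ _ hε.ne'] at hgap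
  linarith [(abs_le.1 hzw).2, (abs_le.1 hzw').1]

theorem abs_sub_lt_of_floor_div_eq (hε : 0 < ε) (h : ⌊z / ε⌋ = ⌊z' / ε⌋) : |z - z'| < ε := by
  have := Int.abs_sub_lt_one_of_floor_eq_floor h
  rwa [← sub_div, abs_div, abs_of_pos hε, div_lt_one hε] at this

theorem abs_floor_le {n : ℕ} (h : |z| ≤ n) : |⌊z⌋| ≤ n := by
  obtain ⟨hneg, hpos⟩ := abs_le.1 h
  refine abs_le.2 ⟨Int.le_floor.2 (by exact_mod_cast hneg), ?_⟩
  exact_mod_cast (Int.floor_le z).trans hpos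

theorem natCeil_div_le_add_one_div {A δ : ℝ} (hA : 0 ≤ A) (hδ : 0 < δ) (hδ1 : δ ≤ 1) :
    (⌈A / δ⌉₊ : ℝ) ≤ (A + 1) / δ := by
  refine (Nat.ceil_lt_add_one (by positivity)).le.trans ?_
  rw [add_div]
  gcongr
  exact (one_le_div hδ).2 hδ1

end Floor

section Sightlines

/-- The inverse slope of the line of sight from `x` to `p`. Among the points above `x` it orders
these lines from left to right. -/
noncomputable def invSlope (x p : ℝ²) : ℝ := (p 0 - x 0) / (p 1 - x 1)

/-- The open unbounded or triangular region above `x` and `y` cut out by the line of inverse slope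
`A` through `x`, on its left, and the line of inverse slope `B` through `y`, on its right. -/
def openTriangle (x y : ℝ²) (A B : ℝ) : Set ℝ² :=
  {p | x 1 < p 1 ∧ A * (p 1 - x 1) < p 0 - x 0 ∧ p 0 - y 0 < B * (p 1 - y 1)}

/-- Seen from `x`, all of `N` lies to the left of all of `N'`. -/
def AppearsLeft (x : ℝ²) (N N' : Set ℝ²) : Prop :=
  ∀ p ∈ N, ∀ q ∈ N', invSlope x p < invSlope x q

/-- The viewpoints from which some point of `N` can be reached by a segment that meets `Γ` only
inside `N`. Unlike the set of viewpoints that see a point of `N`, it is open when `N` is. -/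
def sightSet {E : Type*} [AddCommGroup E] [Module ℝ E] (Γ N : Set E) : Set E :=
  {x | ∃ u ∈ N, segment ℝ x u ∩ Γ ⊆ N}

theorem isOpen_sightSet {E : Type*} [AddCommGroup E] [Module ℝ E] [TopologicalSpace E]
    [IsTopologicalAddGroup E] [ContinuousSMul ℝ E] {Γ N : Set E} (hΓ : IsClosed Γ)
    (hN : IsOpen N) : IsOpen (sightSet Γ N) := by
  have hunion : sightSet Γ N = ⋃ u ∈ N, {x | segment ℝ x u ∩ Γ ⊆ N} := by
    ext x
    simp [sightSet]
  rw [hunion]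
  refine isOpen_biUnion fun u _ => ?_
  have hblocked : IsClosed {z : E × Icc (0 : ℝ) 1 |
      (1 - (z.2 : ℝ)) • z.1 + (z.2 : ℝ) • u ∈ Γ \ N} :=
    (hΓ.sdiff hN).preimage (by fun_prop)
  rw [← isClosed_compl_iff]
  convert isClosedMap_fst_of_compactSpace _ hblocked using 1
  ext x
  simp only [mem_compl_iff, mem_ofPred_eq, not_subset, segment_eq_image, mem_image,
    mem_inter_iff, Set.mem_sdiff]
  constructor
  · rintro ⟨p, ⟨⟨θ, hθ, rfl⟩, hp⟩, hpN⟩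
    exact ⟨(x, ⟨θ, hθ⟩), ⟨hp, hpN⟩, rfl⟩
  · rintro ⟨⟨x', θ, hθ⟩, ⟨hp, hpN⟩, rfl⟩
    exact ⟨_, ⟨⟨θ, hθ, rfl⟩, hp⟩, hpN⟩

variable {Γ : Set ℝ²} {x y p u : ℝ²}

theorem mem_sightSet_of_mem_visiblePart {N : Set ℝ²} (hu : u ∈ visiblePart Γ x) (huN : u ∈ N) :
    x ∈ sightSet Γ N :=
  ⟨u, huN, hu.2 ▸ singleton_subset_iff.2 huN⟩

theorem mem_segment_of_invSlope_eq (hp : x 1 < p 1) (hpu : p 1 ≤ u 1)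
    (h : invSlope x p = invSlope x u) : p ∈ segment ℝ x u := by
  have hp' : 0 < p 1 - x 1 := sub_pos.2 hp
  have hu' : 0 < u 1 - x 1 := sub_pos.2 (hp.trans_le hpu)
  rw [invSlope, invSlope, div_eq_div_iff hp'.ne' hu'.ne'] at h
  rw [segment_eq_image']
  refine ⟨(p 1 - x 1) / (u 1 - x 1), ⟨by positivity, (div_le_one hu').2 (by linarith)⟩,
    PiLp.ext (Fin.forall_fin_two.2 ⟨?_, ?_⟩)⟩ <;>
  · simp only [PiLp.add_apply, PiLp.smul_apply, PiLp.sub_apply, smul_eq_mul]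
    field_simp
    linarith

theorem mem_segment_of_mem_Icc (hxy : x 1 = y 1) (hp : p 1 = x 1) (hp0 : p 0 ∈ Icc (x 0) (y 0)) :
    p ∈ segment ℝ x y := by
  rw [← segment_eq_Icc (hp0.1.trans hp0.2), segment_eq_image'] at hp0
  obtain ⟨θ, hθ, hp0⟩ := hp0
  rw [segment_eq_image']
  refine ⟨θ, hθ, PiLp.ext (Fin.forall_fin_two.2 ⟨hp0, ?_⟩)⟩
  simp [hp, hxy]

theorem invSlope_sub_invSlope (hxy : x 1 = y 1) (p : ℝ²) :
    invSlope x p - invSlope y p = (y 0 - x 0) / (p 1 - x 1) := by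
  rw [invSlope, invSlope, ← hxy, ← sub_div]
  ring

theorem invSlope_sub_invSlope_le (hxy : x 1 = y 1) (hlt : x 0 < y 0) (hu : x 1 < u 1)
    (hup : u 1 ≤ p 1) :
    invSlope x p - invSlope y p ≤ invSlope x u - invSlope y u := by
  rw [invSlope_sub_invSlope hxy, invSlope_sub_invSlope hxy]
  exact div_le_div_of_nonneg_left (sub_pos.2 hlt).le (sub_pos.2 hu) (by linarith)

theorem subset_openTriangle {A B : ℝ} (hΓ : IsPreconnected Γ) (hxy : x 1 = y 1)
    (hbase : Disjoint Γ (segment ℝ x y))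
    (hleft : ∀ p ∈ Γ, x 1 < p 1 → invSlope x p = A → B < invSlope y p)
    (hright : ∀ p ∈ Γ, x 1 < p 1 → invSlope y p = B → invSlope x p < A)
    (hne : (Γ ∩ openTriangle x y A B).Nonempty) : Γ ⊆ openTriangle x y A B := by
  let closedTriangle : Set ℝ² :=
    {p | x 1 ≤ p 1 ∧ A * (p 1 - x 1) ≤ p 0 - x 0 ∧ p 0 - y 0 ≤ B * (p 1 - y 1)}
  have hopen : IsOpen (openTriangle x y A B) := by
    refine IsOpen.and (isOpen_lt ?_ ?_) (IsOpen.and (isOpen_lt ?_ ?_) (isOpen_lt ?_ ?_)) <;>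
      fun_prop
  have hclosed : IsClosed closedTriangle := by
    refine IsClosed.and (isClosed_le ?_ ?_)
      (IsClosed.and (isClosed_le ?_ ?_) (isClosed_le ?_ ?_)) <;> fun_prop
  have hsub : openTriangle x y A B ⊆ closedTriangle :=
    fun p hp => ⟨hp.1.le, hp.2.1.le, hp.2.2.le⟩
  have hboundary : ∀ p ∈ Γ, p ∈ closedTriangle → p ∈ openTriangle x y A B := by
    rintro p hp ⟨hp1, hpA, hpB⟩
    rcases hp1.eq_or_lt with hbottom | hp1
    · rw [← hbottom, sub_self, mul_zero] at hpA
      rw [← hbottom, hxy, sub_self, mul_zero] at hpB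
      exact (disjoint_left.1 hbase hp (mem_segment_of_mem_Icc hxy hbottom.symm
        ⟨by linarith, by linarith⟩)).elim
    have hx : 0 < p 1 - x 1 := sub_pos.2 hp1
    have hy : 0 < p 1 - y 1 := hxy ▸ hx
    have hA : A ≤ invSlope x p := (le_div_iff₀ hx).2 hpA
    have hB : invSlope y p ≤ B := (div_le_iff₀ hy).2 hpB
    exact ⟨hp1,
      (lt_div_iff₀ hx).1 (hA.lt_of_ne fun h => (hleft p hp hp1 h.symm).not_ge hB),
      (div_lt_iff₀ hy).1 (hB.lt_of_ne fun h => (hright p hp hp1 h).not_ge hA)⟩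
  refine hΓ.subset_left_of_subset_union hopen hclosed.isOpen_compl
    (disjoint_compl_right.mono_left hsub) (fun p hp => ?_) hne
  by_cases hpc : p ∈ closedTriangle
  exacts [Or.inl (hboundary p hp hpc), Or.inr hpc]

theorem lt_invSlope_of_invSlope_eq_left {N : Set ℝ²} {B : ℝ} (hxy : x 1 = y 1) (hlt : x 0 < y 0)
    (huN : u ∈ N) (hsight : segment ℝ x u ∩ Γ ⊆ N) (hu : x 1 < u 1)
    (hB : ∀ q ∈ N, B < invSlope y q) (hpΓ : p ∈ Γ) (hp : x 1 < p 1)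
    (h : invSlope x p = invSlope x u) : B < invSlope y p := by
  rcases le_total (p 1) (u 1) with hpu | hup
  · exact hB p (hsight ⟨mem_segment_of_invSlope_eq hp hpu h, hpΓ⟩)
  · linarith [hB u huN, invSlope_sub_invSlope_le hxy hlt hu hup]

theorem invSlope_lt_of_invSlope_eq_right {N : Set ℝ²} {A : ℝ} (hxy : x 1 = y 1) (hlt : x 0 < y 0)
    (huN : u ∈ N) (hsight : segment ℝ y u ∩ Γ ⊆ N) (hu : x 1 < u 1)
    (hA : ∀ q ∈ N, invSlope x q < A) (hpΓ : p ∈ Γ) (hp : x 1 < p 1)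
    (h : invSlope y p = invSlope y u) : invSlope x p < A := by
  rcases le_total (p 1) (u 1) with hpu | hup
  · exact hA p (hsight ⟨mem_segment_of_invSlope_eq (hxy ▸ hp) hpu h, hpΓ⟩)
  · linarith [hA u huN, invSlope_sub_invSlope_le hxy hlt hu hup]

/-- Otherwise the line of sight from `x` to `W` and the one from `y` to `U` cross below `W` and `U`,
so that with the segment from `x` to `y` they cut `V` off from `W`. -/
theorem not_appearsLeft_of_sightSet (hΓ : IsPreconnected Γ) (hxy : x 1 = y 1) (hlt : x 0 < y 0)
    (hbase : Disjoint Γ (segment ℝ x y)) {U W V : Set ℝ²} (hU : ∀ p ∈ U, x 1 < p 1)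
    (hW : ∀ p ∈ W, x 1 < p 1) (hV : ∀ p ∈ V, x 1 < p 1) (hyU : y ∈ sightSet Γ U)
    (hxW : x ∈ sightSet Γ W) (hWne : (Γ ∩ W).Nonempty) (hVne : (Γ ∩ V).Nonempty)
    (hUW : AppearsLeft x U W) (hWV : AppearsLeft x W V) (hVU : AppearsLeft y V U) :
    ¬AppearsLeft y U W := by
  intro hUW'
  obtain ⟨u, huU, hu⟩ := hyU
  obtain ⟨w, hwW, hw⟩ := hxW
  obtain ⟨v, hvΓ, hvV⟩ := hVne
  obtain ⟨w', hw'Γ, hw'W⟩ := hWne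
  have hinside : v ∈ openTriangle x y (invSlope x w) (invSlope y u) :=
    ⟨hV v hvV, (lt_div_iff₀ (sub_pos.2 (hV v hvV))).1 (hWV w hwW v hvV),
      (div_lt_iff₀ (sub_pos.2 (hxy ▸ hV v hvV))).1 (hVU v hvV u huU)⟩
  have hsub : Γ ⊆ openTriangle x y (invSlope x w) (invSlope y u) :=
    subset_openTriangle hΓ hxy hbase
      (fun p hpΓ hp => lt_invSlope_of_invSlope_eq_left hxy hlt hwW hw (hW w hwW)
        (hUW' u huU) hpΓ hp)
      (fun p hpΓ hp => invSlope_lt_of_invSlope_eq_right hxy hlt huU hu (hU u huU)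
        (fun q hq => hUW q hq w hwW) hpΓ hp)
      ⟨v, hvΓ, hinside⟩
  have hw'left : invSlope y w' < invSlope y u :=
    (div_lt_iff₀ (sub_pos.2 (hxy ▸ hW w' hw'W))).2 (hsub hw'Γ).2.2
  exact (hUW' u huU w' hw'W).not_gt hw'left

end Sightlines

section Cubes

variable {ι : Type*}

/-- The open cube of half-side `r` about `x`. -/
def cube (x : EuclideanSpace ℝ ι) (r : ℝ) : Set (EuclideanSpace ℝ ι) :=
  {p | ∀ i, |p i - x i| < r}

/-- The lattice point `r • m`. -/
def gridPoint (r : ℝ) (m : ι → ℤ) : EuclideanSpace ℝ ι := WithLp.toLp 2 fun i => r * m i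

/-- The open cube of half-side `r` about the lattice point `r • m`. Neighbouring grid cubes overlap,
so that every sufficiently small set lies in one of them. -/
def gridCube (r : ℝ) (m : ι → ℤ) : Set (EuclideanSpace ℝ ι) := cube (gridPoint r m) r

theorem mem_cube_self (x : EuclideanSpace ℝ ι) {r : ℝ} (hr : 0 < r) : x ∈ cube x r :=
  fun i => by rwa [sub_self, abs_zero]

theorem isOpen_cube [Finite ι] (x : EuclideanSpace ℝ ι) (r : ℝ) : IsOpen (cube x r) := by
  simp only [cube, ofPred_forall]
  exact isOpen_iInter_of_finite fun i => isOpen_lt (by fun_prop) continuous_const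

theorem convex_cube (x : EuclideanSpace ℝ ι) (r : ℝ) : Convex ℝ (cube x r) := by
  simp only [cube, ofPred_forall]
  exact convex_iInter fun i =>
    (convex_ball (x i) r).linear_preimage (EuclideanSpace.proj (𝕜 := ℝ) i).toLinearMap

theorem cube_subset_closedBall [Fintype ι] (x : EuclideanSpace ℝ ι) {r : ℝ} (hr : 0 ≤ r) :
    cube x r ⊆ Metric.closedBall x (√(Fintype.card ι) * r) := by
  intro p hp
  rw [Metric.mem_closedBall, EuclideanSpace.dist_eq]
  refine Real.sqrt_le_iff.2 ⟨by positivity, ?_⟩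
  calc ∑ i, dist (p i) (x i) ^ 2 ≤ ∑ _i : ι, r ^ 2 :=
        Finset.sum_le_sum fun i _ => pow_le_pow_left₀ dist_nonneg (hp i).le 2
    _ = (√(Fintype.card ι) * r) ^ 2 := by
        rw [Finset.sum_const, Finset.card_univ, nsmul_eq_mul, mul_pow,
          Real.sq_sqrt (Nat.cast_nonneg _)]

theorem ediam_cube_le [Fintype ι] (x : EuclideanSpace ℝ ι) {r : ℝ} (hr : 0 ≤ r) :
    Metric.ediam (cube x r) ≤ ENNReal.ofReal (2 * √(Fintype.card ι) * r) := by
  calc Metric.ediam (cube x r) ≤ Metric.ediam (Metric.closedBall x (√(Fintype.card ι) * r)) :=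
        Metric.ediam_mono (cube_subset_closedBall x hr)
    _ ≤ 2 * ENNReal.ofReal (√(Fintype.card ι) * r) := by
        rw [← Metric.closedEBall_ofReal (by positivity)]
        exact Metric.ediam_closedEBall_le
    _ = ENNReal.ofReal (2 * √(Fintype.card ι) * r) := by
        rw [mul_assoc, ENNReal.ofReal_mul zero_le_two, ENNReal.ofReal_ofNat]

theorem eventually_cube_subset [Finite ι] {x : EuclideanSpace ℝ ι} {U : Set (EuclideanSpace ℝ ι)}
    (hU : U ∈ 𝓝 x) : ∀ᶠ r in 𝓝[>] (0 : ℝ), cube x r ⊆ U := by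
  have := Fintype.ofFinite ι
  obtain ⟨ρ, hρ, hball⟩ := Metric.nhds_basis_closedBall.mem_iff.1 hU
  have hsmall : ∀ᶠ r in 𝓝 (0 : ℝ), √(Fintype.card ι) * r < ρ :=
    (continuous_const_mul _).continuousAt.eventually_lt continuousAt_const (by simpa using hρ)
  filter_upwards [hsmall.filter_mono nhdsWithin_le_nhds, self_mem_nhdsWithin] with r hr hr0
  exact (cube_subset_closedBall x (le_of_lt hr0)).trans
    ((Metric.closedBall_subset_closedBall hr.le).trans hball)

theorem exists_subset_gridCube [Fintype ι] {A : Set (EuclideanSpace ℝ ι)} {r : ℝ} (hr : 0 < r)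
    (hA : Metric.ediam A ≤ ENNReal.ofReal (r / 4)) : ∃ m, A ⊆ gridCube r m := by
  rcases A.eq_empty_or_nonempty with rfl | ⟨p, hp⟩
  · exact ⟨0, empty_subset _⟩
  refine ⟨fun i => round (p i / r), fun q hq i => ?_⟩
  have hqp : |q i - p i| ≤ r / 4 := by
    have hedist := (Metric.edist_le_ediam_of_mem hq hp).trans hA
    rw [edist_dist, ENNReal.ofReal_le_ofReal_iff (by positivity), dist_eq_norm] at hedist
    exact (PiLp.norm_apply_le (q - p) i).trans hedist
  have hround : |p i - r * round (p i / r)| ≤ r / 2 := by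
    have hscale : p i - r * round (p i / r) = r * (p i / r - round (p i / r)) := by field_simp
    rw [hscale, abs_mul, abs_of_pos hr]
    linarith [mul_le_mul_of_nonneg_left (abs_sub_round (p i / r)) hr.le]
  calc |q i - r * round (p i / r)| ≤ |q i - p i| + |p i - r * round (p i / r)| :=
        abs_sub_le _ _ _
    _ < r := by linarith

theorem card_le_of_abs_gridPoint_le [Fintype ι] {M : Finset (ι → ℤ)} {r R : ℝ} (hr : 0 < r)
    (hr1 : r ≤ 1) (hR : 0 ≤ R) (hM : ∀ m ∈ M, ∀ i, |gridPoint r m i| ≤ R) :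
    (M.card : ℝ) ≤ ((2 * R + 1) / r) ^ Fintype.card ι := by
  classical
  set n := ⌊R / r⌋₊
  have hsub : M ⊆ Fintype.piFinset fun _ : ι => Finset.Icc (-n : ℤ) n := by
    intro m hm
    refine Fintype.mem_piFinset.2 fun i => Finset.mem_Icc.2 (abs_le.1 ?_)
    have hmi := hM m hm i
    rw [gridPoint, abs_mul, abs_of_pos hr, ← le_div_iff₀' hr] at hmi
    rw [Int.abs_eq_natAbs, Nat.cast_le]
    refine Nat.le_floor ?_
    rwa [Nat.cast_natAbs, Int.cast_abs]
  have hn : (2 * n + 1 : ℝ) ≤ (2 * R + 1) / r := by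
    rw [add_div, mul_div_assoc]
    gcongr
    · exact Nat.floor_le (by positivity)
    · exact (one_le_div hr).2 hr1
  calc (M.card : ℝ) ≤ (2 * n + 1 : ℝ) ^ Fintype.card ι := by
        have hcard := Finset.card_le_card hsub
        rw [Fintype.card_piFinset, Finset.prod_const, Finset.card_univ, Int.card_Icc,
          show ((n : ℤ) + 1 - -n).toNat = 2 * n + 1 by omega] at hcard
        exact_mod_cast hcard
    _ ≤ _ := by gcongr

end Cubes

section CommonSight

/-- The points above `x` at height between `c` and `R` whose horizontal distance to `x` is at most
`R`. -/
def window (x : ℝ²) (c R : ℝ) : Set ℝ² := {p | c ≤ p 1 - x 1 ∧ p 1 - x 1 ≤ R ∧ |p 0 - x 0| ≤ R}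

/-- The pair of inverse slopes at which `p` is seen from `x` and from `y`, rounded to multiples
of `ε`. -/
noncomputable def slopeCell (x y : ℝ²) (ε : ℝ) (p : ℝ²) : ℤ × ℤ :=
  (⌊invSlope x p / ε⌋, ⌊invSlope y p / ε⌋)

variable {x y p q : ℝ²} {c R r ε : ℝ}

theorem abs_invSlope_le (hc : 0 < c) (hp : p ∈ window x c R) : |invSlope x p| ≤ R / c := by
  rw [invSlope, abs_div, abs_of_pos (hc.trans_le hp.1)]
  exact div_le_div₀ ((abs_nonneg _).trans hp.2.2) hp.2.2 hc hp.1

theorem abs_invSlope_sub_le {ρ : ℝ} (hc : 0 < c) (hp : p ∈ window x c R) (hq : q ∈ window x c R)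
    (h : ∀ i, |p i - q i| ≤ ρ) : |invSlope x p - invSlope x q| ≤ (1 / c + R / c ^ 2) * ρ := by
  have hp' : 0 < p 1 - x 1 := hc.trans_le hp.1
  have hq' : 0 < q 1 - x 1 := hc.trans_le hq.1
  have hsplit : invSlope x p - invSlope x q =
      ((p 0 - q 0) - invSlope x q * (p 1 - q 1)) / (p 1 - x 1) := by
    unfold invSlope
    field_simp
    ring
  have hnum : |(p 0 - q 0) - invSlope x q * (p 1 - q 1)| ≤ ρ + R / c * ρ := by
    refine (abs_sub _ _).trans (add_le_add (h 0) ?_)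
    rw [abs_mul]
    exact mul_le_mul (abs_invSlope_le hc hq) (h 1) (abs_nonneg _)
      ((abs_nonneg _).trans (abs_invSlope_le hc hq))
  calc |invSlope x p - invSlope x q| ≤ (ρ + R / c * ρ) / c := by
        rw [hsplit, abs_div, abs_of_pos hp']
        exact div_le_div₀ ((abs_nonneg _).trans hnum) hnum hc hp.1
    _ = (1 / c + R / c ^ 2) * ρ := by field_simp

theorem abs_sub_lt_of_abs_invSlope_sub_lt (hc : 0 < c) (hp : p ∈ window x c R)
    (hpq : p 1 = q 1) (h : |invSlope x p - invSlope x q| < ε) : |p 0 - q 0| < ε * R := by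
  have hp' : 0 < p 1 - x 1 := hc.trans_le hp.1
  have hε : 0 < ε := (abs_nonneg _).trans_lt h
  rw [invSlope, invSlope, ← hpq, ← sub_div, sub_sub_sub_cancel_right, abs_div, abs_of_pos hp',
    div_lt_iff₀ hp'] at h
  exact h.trans_le (mul_le_mul_of_nonneg_left hp.2.1 hε.le)

theorem mul_abs_sub_lt_of_abs_invSlope_sub_lt (hxy : x 1 = y 1) (hlt : x 0 < y 0) (hc : 0 < c)
    (hp : p ∈ window x c R) (hq : q ∈ window x c R) (hx : |invSlope x p - invSlope x q| < ε)
    (hy : |invSlope y p - invSlope y q| < ε) : (y 0 - x 0) * |p 1 - q 1| < 2 * ε * R ^ 2 := by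
  have hp' : 0 < p 1 - x 1 := hc.trans_le hp.1
  have hq' : 0 < q 1 - x 1 := hc.trans_le hq.1
  have hd : 0 < y 0 - x 0 := sub_pos.2 hlt
  have hε : 0 < ε := (abs_nonneg _).trans_lt hx
  have hdiff : (invSlope x q - invSlope y q) - (invSlope x p - invSlope y p) =
      (y 0 - x 0) * (p 1 - q 1) / ((p 1 - x 1) * (q 1 - x 1)) := by
    rw [invSlope_sub_invSlope hxy, invSlope_sub_invSlope hxy]
    field_simp
    ring
  have hlt2 : |(y 0 - x 0) * (p 1 - q 1) / ((p 1 - x 1) * (q 1 - x 1))| < 2 * ε := by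
    rw [← hdiff]
    rw [abs_lt] at *
    constructor <;> linarith [hx.1, hx.2, hy.1, hy.2]
  rw [abs_div, abs_mul, abs_of_pos hd, abs_of_pos (mul_pos hp' hq'),
    div_lt_iff₀ (mul_pos hp' hq')] at hlt2
  calc _ < 2 * ε * ((p 1 - x 1) * (q 1 - x 1)) := hlt2
    _ ≤ 2 * ε * (R * R) := by
        gcongr
        exacts [hp'.le.trans hp.2.1, hp.2.1, hq.2.1]
    _ = 2 * ε * R ^ 2 := by ring

theorem appearsLeft_gridCube {m m' : Fin 2 → ℤ} (hc : 0 < c) (hr : 0 < r) (hε : 0 < ε)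
    (hrε : (1 / c + R / c ^ 2) * r ≤ ε) (hm : gridCube r m ⊆ window x c R)
    (hm' : gridCube r m' ⊆ window x c R)
    (h : ⌊invSlope x (gridPoint r m) / ε⌋ + 3 ≤ ⌊invSlope x (gridPoint r m') / ε⌋) :
    AppearsLeft x (gridCube r m) (gridCube r m') :=
  fun _ hp _ hq => lt_of_floor_div_add_three_le hε
    ((abs_invSlope_sub_le hc (hm hp) (hm (mem_cube_self _ hr)) fun i => (hp i).le).trans hrε)
    ((abs_invSlope_sub_le hc (hm' hq) (hm' (mem_cube_self _ hr)) fun i => (hq i).le).trans hrε) h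

variable {Γ : Set ℝ²} {M : Finset (Fin 2 → ℤ)}

theorem avoidsPattern231_image_slopeCell (hΓ : IsPreconnected Γ) (hxy : x 1 = y 1)
    (hlt : x 0 < y 0) (hbase : Disjoint Γ (segment ℝ x y)) (hc : 0 < c) (hr : 0 < r) (hε : 0 < ε)
    (hrε : (1 / c + R / c ^ 2) * r ≤ ε) (hne : ∀ m ∈ M, (Γ ∩ gridCube r m).Nonempty)
    (hwx : ∀ m ∈ M, gridCube r m ⊆ window x c R) (hwy : ∀ m ∈ M, gridCube r m ⊆ window y c R)
    (hsx : ∀ m ∈ M, x ∈ sightSet Γ (gridCube r m))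
    (hsy : ∀ m ∈ M, y ∈ sightSet Γ (gridCube r m)) :
    AvoidsPattern231 (M.image fun m => slopeCell x y ε (gridPoint r m)) 3 := by
  intro u hu w hw v hv
  obtain ⟨u, huM, rfl⟩ := Finset.mem_image.1 hu
  obtain ⟨w, hwM, rfl⟩ := Finset.mem_image.1 hw
  obtain ⟨v, hvM, rfl⟩ := Finset.mem_image.1 hv
  intro huw hwv hvu huw'
  have habove : ∀ m ∈ M, ∀ p ∈ gridCube r m, x 1 < p 1 :=
    fun m hm p hp => sub_pos.1 (hc.trans_le (hwx m hm hp).1)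
  have hleft {m m'} (hm : m ∈ M) (hm' : m' ∈ M) :=
    appearsLeft_gridCube hc hr hε hrε (hwx m hm) (hwx m' hm')
  have hleft' {m m'} (hm : m ∈ M) (hm' : m' ∈ M) :=
    appearsLeft_gridCube hc hr hε hrε (hwy m hm) (hwy m' hm')
  exact not_appearsLeft_of_sightSet hΓ hxy hlt hbase (habove u huM) (habove w hwM) (habove v hvM)
    (hsy u huM) (hsx w hwM) (hne w hwM) (hne v hvM) (hleft huM hwM huw) (hleft hwM hvM hwv)
    (hleft' hvM huM hvu) (hleft' huM hwM huw')

theorem card_image_slopeCell_le (hΓ : IsPreconnected Γ) (hxy : x 1 = y 1)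
    (hlt : x 0 < y 0) (hbase : Disjoint Γ (segment ℝ x y)) (hc : 0 < c) (hr : 0 < r) (hε : 0 < ε)
    (hrε : (1 / c + R / c ^ 2) * r ≤ ε) (hne : ∀ m ∈ M, (Γ ∩ gridCube r m).Nonempty)
    (hwx : ∀ m ∈ M, gridCube r m ⊆ window x c R) (hwy : ∀ m ∈ M, gridCube r m ⊆ window y c R)
    (hsx : ∀ m ∈ M, x ∈ sightSet Γ (gridCube r m))
    (hsy : ∀ m ∈ M, y ∈ sightSet Γ (gridCube r m)) :
    (M.image fun m => slopeCell x y ε (gridPoint r m)).card ≤ 3 * (8 * ⌈R / c / ε⌉₊ + 3) := by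
  refine (avoidsPattern231_image_slopeCell hΓ hxy hlt hbase hc hr hε hrε hne hwx hwy hsx
    hsy).card_le_of_abs_le ?_
  have hsize {z p : ℝ²} (hp : p ∈ window z c R) : |⌊invSlope z p / ε⌋| ≤ ⌈R / c / ε⌉₊ := by
    refine abs_floor_le (le_trans ?_ (Nat.le_ceil _))
    rw [abs_div, abs_of_pos hε]
    gcongr
    exact abs_invSlope_le hc hp
  exact Finset.forall_mem_image.2 fun m hm =>
    ⟨hsize (hwx m hm (mem_cube_self _ hr)), hsize (hwy m hm (mem_cube_self _ hr))⟩

theorem card_le_of_slopeCell_eq (hxy : x 1 = y 1) (hlt : x 0 < y 0) (hc : 0 < c) (hr : 0 < r)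
    (hε : 0 < ε) (hw : ∀ m ∈ M, gridPoint r m ∈ window x c R)
    (hcell : ∀ m ∈ M, ∀ m' ∈ M,
      slopeCell x y ε (gridPoint r m) = slopeCell x y ε (gridPoint r m')) :
    M.card ≤ ⌈ε * R / r⌉₊ * ⌈2 * ε * R ^ 2 / r / (y 0 - x 0)⌉₊ := by
  have hd : 0 < y 0 - x 0 := sub_pos.2 hlt
  have hslope_x : ∀ m ∈ M, ∀ m' ∈ M,
      |invSlope x (gridPoint r m) - invSlope x (gridPoint r m')| < ε :=
    fun m hm m' hm' => abs_sub_lt_of_floor_div_eq hε (congrArg Prod.fst (hcell m hm m' hm'))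
  have hslope_y : ∀ m ∈ M, ∀ m' ∈ M,
      |invSlope y (gridPoint r m) - invSlope y (gridPoint r m')| < ε :=
    fun m hm m' hm' => abs_sub_lt_of_floor_div_eq hε (congrArg Prod.snd (hcell m hm m' hm'))
  have hcoord : ∀ (m m' : Fin 2 → ℤ) (i : Fin 2) {B : ℝ},
      |gridPoint r m' i - gridPoint r m i| < B → m' i < m i + ⌈B / r⌉₊ := by
    intro m m' i B h
    have hlt : (m' i - m i : ℝ) < B / r := by
      rw [lt_div_iff₀' hr, mul_sub]
      exact (abs_lt.1 h).2
    have hceil : (m' i - m i : ℝ) < ⌈B / r⌉₊ := hlt.trans_le (Nat.le_ceil _)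
    rw [sub_lt_iff_lt_add'] at hceil
    exact_mod_cast hceil
  refine card_le_mul_of_forall_lt_add (fun m hm m' hm' hmm => hcoord m m' 0 ?_)
    (fun m hm m' hm' => ?_)
  · exact abs_sub_lt_of_abs_invSlope_sub_lt hc (hw m' hm') (by simp [gridPoint, hmm])
      (hslope_x m' hm' m hm)
  · rw [div_right_comm]
    refine hcoord m m' 1 ((lt_div_iff₀' hd).2 ?_)
    exact mul_abs_sub_lt_of_abs_invSlope_sub_lt hxy hlt hc (hw m' hm') (hw m hm)
      (hslope_x m' hm' m hm) (hslope_y m' hm' m hm)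

theorem exists_card_common_sight_le (hc : 0 < c) (hR : 0 < R) :
    ∃ C : ℝ, 0 < C ∧ ∀ {Γ : Set ℝ²} {x y : ℝ²} {r : ℝ} {M : Finset (Fin 2 → ℤ)},
      IsPreconnected Γ → x 1 = y 1 → x 0 < y 0 → y 0 ≤ x 0 + 1 → Disjoint Γ (segment ℝ x y) →
      0 < r → r ≤ 1 → (∀ m ∈ M, (Γ ∩ gridCube r m).Nonempty) →
      (∀ m ∈ M, gridCube r m ⊆ window x c R) → (∀ m ∈ M, gridCube r m ⊆ window y c R) →
      (∀ m ∈ M, x ∈ sightSet Γ (gridCube r m)) → (∀ m ∈ M, y ∈ sightSet Γ (gridCube r m)) →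
      (M.card : ℝ) ≤ C / (r * (y 0 - x 0)) := by
  classical
  set L := 1 / c + R / c ^ 2
  have hL0 : 0 < L := by positivity
  refine ⟨(L * R + 1) * (2 * L * R ^ 2 + 1) * (3 * (8 * (R / (c * L) + 1) + 3)), by positivity, ?_⟩
  intro Γ x y r M hΓ hxy hlt hle hbase hr hr1 hne hwx hwy hsx hsy
  have hd : 0 < y 0 - x 0 := sub_pos.2 hlt
  have hε : 0 < L * r := by positivity
  set cell := fun m => slopeCell x y (L * r) (gridPoint r m)
  have hfiber : ∀ b ∈ M.image cell, (M.filter fun m => cell m = b).card ≤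
      ⌈L * R / 1⌉₊ * ⌈2 * L * R ^ 2 / (y 0 - x 0)⌉₊ := by
    intro b _
    have h := card_le_of_slopeCell_eq (M := M.filter fun m => cell m = b) hxy hlt hc hr hε
      (fun m hm => hwx m (Finset.mem_filter.1 hm).1 (mem_cube_self _ hr))
      (fun m hm m' hm' => (Finset.mem_filter.1 hm).2.trans (Finset.mem_filter.1 hm').2.symm)
    convert h using 3 <;> field_simp
  set n := ⌈R / c / (L * r)⌉₊
  have hcells : (M.image cell).card ≤ 3 * (8 * n + 3) :=
    card_image_slopeCell_le hΓ hxy hlt hbase hc hr hε le_rfl hne hwx hwy hsx hsy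
  have hcard : (M.card : ℝ) ≤
      ⌈L * R / 1⌉₊ * ⌈2 * L * R ^ 2 / (y 0 - x 0)⌉₊ * (3 * (8 * n + 3)) := by
    exact_mod_cast (Finset.card_le_mul_card_image M _ hfiber).trans (Nat.mul_le_mul_left _ hcells)
  have hcells' : (3 * (8 * n + 3) : ℝ) ≤ 3 * (8 * (R / (c * L) + 1) + 3) / r := by
    have hn : (n : ℝ) ≤ (R / (c * L) + 1) / r := by
      simpa only [n, div_div, mul_assoc] using
        natCeil_div_le_add_one_div (A := R / (c * L)) (by positivity) hr hr1
    have h1r : 3 ≤ 3 / r := (le_div_iff₀ hr).2 (by linarith)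
    linarith [show 3 * (8 * (R / (c * L) + 1) + 3) / r
      = 3 * (8 * ((R / (c * L) + 1) / r) + 3 / r) by ring]
  calc (M.card : ℝ) ≤ _ := hcard
    _ ≤ (L * R + 1) / 1 * ((2 * L * R ^ 2 + 1) / (y 0 - x 0)) *
        (3 * (8 * (R / (c * L) + 1) + 3) / r) := by
      gcongr <;> refine natCeil_div_le_add_one_div (by positivity) ?_ ?_ <;> linarith
    _ = _ := by field_simp

end CommonSight

section SumOfSquares

variable {ι : Type*} {M : Finset ι}

theorem sum_measure_sq_eq_lintegral_lintegral {α : Type*} [MeasurableSpace α] {μ : Measure α}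
    {A : ι → Set α} [∀ i x, Decidable (x ∈ A i)] (hA : ∀ i ∈ M, MeasurableSet (A i)) :
    ∑ i ∈ M, μ (A i) ^ 2 =
      ∫⁻ x, ∫⁻ y, ((M.filter fun i => x ∈ A i ∧ y ∈ A i).card : ℝ≥0∞) ∂μ ∂μ := by
  have hind : ∀ i ∈ M, Measurable ((A i).indicator (1 : α → ℝ≥0∞)) :=
    fun i hi => measurable_one.indicator (hA i hi)
  have hcount : ∀ x y, ((M.filter fun i => x ∈ A i ∧ y ∈ A i).card : ℝ≥0∞) =
      ∑ i ∈ M, (A i).indicator 1 x * (A i).indicator 1 y := by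
    intro x y
    rw [Finset.card_filter, Nat.cast_sum]
    refine Finset.sum_congr rfl fun i _ => ?_
    by_cases hx : x ∈ A i <;> by_cases hy : y ∈ A i <;> simp [hx, hy]
  have hinner : ∀ x, ∫⁻ y, ((M.filter fun i => x ∈ A i ∧ y ∈ A i).card : ℝ≥0∞) ∂μ =
      ∑ i ∈ M, (A i).indicator 1 x * μ (A i) := by
    intro x
    simp_rw [hcount]
    rw [lintegral_finsetSum _ fun i hi => (hind i hi).const_mul _]
    refine Finset.sum_congr rfl fun i hi => ?_
    rw [lintegral_const_mul _ (hind i hi), lintegral_indicator_one (hA i hi)]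
  simp_rw [hinner]
  rw [lintegral_finsetSum _ fun i hi => (hind i hi).mul_const _]
  refine Finset.sum_congr rfl fun i hi => ?_
  rw [lintegral_mul_const _ (hind i hi), lintegral_indicator_one (hA i hi), sq]

theorem sum_measure_sq_le_mul_lintegral {G : Type*} [AddGroup G] [MeasurableSpace G]
    [MeasurableAdd G] {μ : Measure G} [μ.IsAddRightInvariant] [NullSingletonClass μ]
    {A : ι → Set G} [∀ i x, Decidable (x ∈ A i)] {I : Set G} {φ : G → ℝ≥0∞}
    (hA : ∀ i ∈ M, MeasurableSet (A i)) (hAI : ∀ i ∈ M, A i ⊆ I)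
    (hφ : ∀ x ∈ I, ∀ y ∈ I, x ≠ y → (M.filter fun i => x ∈ A i ∧ y ∈ A i).card ≤ φ (y - x)) :
    ∑ i ∈ M, μ (A i) ^ 2 ≤ (∫⁻ u, φ u ∂μ) * μ I := by
  have hpoint : ∀ x y, x ≠ y → ((M.filter fun i => x ∈ A i ∧ y ∈ A i).card : ℝ≥0∞) ≤
      I.indicator (fun _ => φ (y - x)) x := by
    intro x y hxy
    rcases (M.filter fun i => x ∈ A i ∧ y ∈ A i).eq_empty_or_nonempty with hempty | ⟨i, hi⟩
    · simp [hempty]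
    · obtain ⟨hiM, hx, hy⟩ := Finset.mem_filter.1 hi
      rw [indicator_of_mem (hAI i hiM hx)]
      exact hφ x (hAI i hiM hx) y (hAI i hiM hy) hxy
  rw [sum_measure_sq_eq_lintegral_lintegral hA]
  refine le_trans (lintegral_mono fun x => ?_) (lintegral_indicator_const_le I _)
  calc ∫⁻ y, ((M.filter fun i => x ∈ A i ∧ y ∈ A i).card : ℝ≥0∞) ∂μ
      ≤ ∫⁻ y, I.indicator (fun _ => φ (y - x)) x ∂μ :=
        lintegral_mono_ae ((Measure.ae_ne μ x).mono fun y hy => hpoint x y hy.symm)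
    _ = I.indicator (fun _ => ∫⁻ u, φ u ∂μ) x := by
        by_cases hx : x ∈ I
        · simp only [indicator_of_mem hx, lintegral_sub_right_eq_self φ x]
        · simp only [indicator_of_notMem hx, lintegral_zero]

theorem le_mul_rpow_mul_rpow {N C r d ε : ℝ} (hN : 0 ≤ N) (hr : 0 < r) (hd : 0 < d)
    (hε : 0 ≤ ε) (hε1 : ε ≤ 1) (hNr : N ≤ C / r ^ 2) (hNd : N ≤ C / (r * d)) :
    N ≤ C * r ^ (-1 - ε) * d ^ (ε - 1) := by
  have hC : 0 ≤ C := by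
    have := hN.trans hNr
    rwa [le_div_iff₀ (by positivity), zero_mul] at this
  calc N = N ^ ε * N ^ (1 - ε) := by
        rw [← Real.rpow_add' hN (by simp), add_sub_cancel, Real.rpow_one]
    _ ≤ (C / r ^ 2) ^ ε * (C / (r * d)) ^ (1 - ε) := by
        have := sub_nonneg.2 hε1
        gcongr
    _ = C ^ (ε + (1 - ε)) * (r ^ (-(2 * ε) - (1 - ε)) * d ^ (-(1 - ε))) := by
        rw [Real.rpow_add' hC (by simp), Real.rpow_sub hr, Real.rpow_neg hr.le, Real.rpow_mul hr.le,
          Real.rpow_neg hd.le, Real.div_rpow hC (by positivity), Real.div_rpow hC (by positivity),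
          Real.mul_rpow hr.le hd.le, Real.rpow_two]
        field_simp
    _ = C * r ^ (-1 - ε) * d ^ (ε - 1) := by
        rw [add_sub_cancel, Real.rpow_one, neg_sub, mul_assoc]
        ring_nf

theorem setLIntegral_ball_rpow_lt_top {ε : ℝ} (hε : 0 < ε) :
    ∫⁻ u in Metric.ball (0 : ℝ) 1, ENNReal.ofReal (|u| ^ (ε - 1)) < ⊤ := by
  refine Integrable.lintegral_lt_top (integrableOn_ball_of_norm_le_rpow (C := 1) (α := 1 - ε)
    (by simp) (by simpa using hε) (.of_forall fun u => ?_)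
    (Measurable.aestronglyMeasurable (by fun_prop)))
  rw [Real.norm_eq_abs, Real.norm_eq_abs, one_mul, neg_sub, abs_of_nonneg (by positivity)]

theorem sum_volume_sq_le {A : ι → Set ℝ} [∀ i x, Decidable (x ∈ A i)] {a b C r ε : ℝ}
    (hA : ∀ i ∈ M, MeasurableSet (A i)) (hAI : ∀ i ∈ M, A i ⊆ Ioo a b) (hab : b - a ≤ 1)
    (hr : 0 < r) (hε : 0 ≤ ε) (hε1 : ε ≤ 1) (hcard : (M.card : ℝ) ≤ C / r ^ 2)
    (hpair : ∀ x ∈ Ioo a b, ∀ y ∈ Ioo a b, x < y →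
      ((M.filter fun i => x ∈ A i ∧ y ∈ A i).card : ℝ) ≤ C / (r * (y - x))) :
    ∑ i ∈ M, volume (A i) ^ 2 ≤ ENNReal.ofReal (C * r ^ (-1 - ε)) *
      ∫⁻ u in Metric.ball (0 : ℝ) 1, ENNReal.ofReal (|u| ^ (ε - 1)) := by
  have hpair' : ∀ x ∈ Ioo a b, ∀ y ∈ Ioo a b, x ≠ y →
      ((M.filter fun i => x ∈ A i ∧ y ∈ A i).card : ℝ) ≤ C / (r * |y - x|) := by
    intro x hx y hy hxy
    rcases hxy.lt_or_gt with h | h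
    · rw [abs_of_pos (sub_pos.2 h)]
      exact hpair x hx y hy h
    · rw [abs_sub_comm, abs_of_pos (sub_pos.2 h)]
      simpa only [and_comm] using hpair y hy x hx h
  have hcount : ∀ x ∈ Ioo a b, ∀ y ∈ Ioo a b, x ≠ y →
      ((M.filter fun i => x ∈ A i ∧ y ∈ A i).card : ℝ≥0∞) ≤ (Metric.ball (0 : ℝ) 1).indicator
        (fun u => ENNReal.ofReal (C * r ^ (-1 - ε)) * ENNReal.ofReal (|u| ^ (ε - 1))) (y - x) := by
    intro x hx y hy hxy
    have hball : y - x ∈ Metric.ball (0 : ℝ) 1 := by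
      rw [mem_ball_zero_iff, Real.norm_eq_abs, abs_lt]
      constructor <;> linarith [hx.1, hx.2, hy.1, hy.2]
    rw [indicator_of_mem hball, ← ENNReal.ofReal_mul' (by positivity), ← ENNReal.ofReal_natCast]
    refine ENNReal.ofReal_le_ofReal (le_mul_rpow_mul_rpow (Nat.cast_nonneg _) hr
      (abs_pos.2 (sub_ne_zero.2 hxy.symm)) hε hε1 (le_trans ?_ hcard) (hpair' x hx y hy hxy))
    exact_mod_cast Finset.card_filter_le _ _
  have hvol : volume (Ioo a b) ≤ 1 := by
    rw [Real.volume_Ioo]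
    exact ENNReal.ofReal_le_one.2 hab
  calc ∑ i ∈ M, volume (A i) ^ 2 ≤ _ * volume (Ioo a b) :=
        sum_measure_sq_le_mul_lintegral hA hAI hcount
    _ ≤ _ := by
        rw [lintegral_indicator Metric.isOpen_ball.measurableSet,
          lintegral_const_mul _ (by fun_prop)]
        exact mul_le_of_le_one_right' hvol

end SumOfSquares

section Slices

/-- The slice of `S` at height `h`, as a set of first coordinates. -/
def horizontalSlice (S : Set ℝ²) (h : ℝ) : Set ℝ := {s | !₂[s, h] ∈ S}

variable {S : Set ℝ²}

theorem measurableSet_horizontalSlice (hS : MeasurableSet S) (h : ℝ) :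
    MeasurableSet (horizontalSlice S h) := by
  have hcont : Continuous fun s : ℝ => (!₂[s, h] : ℝ²) := by fun_prop
  exact hcont.measurable hS

theorem measurable_volume_horizontalSlice (hS : MeasurableSet S) :
    Measurable fun h => volume (horizontalSlice S h) := by
  have hcont : Continuous fun z : ℝ × ℝ => (!₂[z.2, z.1] : ℝ²) := by fun_prop
  exact measurable_measure_prodMk_left (hcont.measurable hS)

theorem volume_eq_lintegral_horizontalSlice (hS : MeasurableSet S) :
    volume S = ∫⁻ h, volume (horizontalSlice S h) := by
  have htoLp := (EuclideanSpace.volume_preserving_symm_measurableEquiv_toLp (Fin 2)).symm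
  have hpi := (volume_preserving_finTwoArrow ℝ).symm
  have hswap := (htoLp.comp hpi).comp (Measure.measurePreserving_swap (μ := volume) (ν := volume))
  rw [← hswap.measure_preimage hS.nullMeasurableSet,
    Measure.prod_apply (hswap.measurable hS)]
  rfl

theorem le_add_inv_mul_sq {a l : ℝ≥0∞} (hl : l ≠ 0) (hl' : l ≠ ⊤) : a ≤ l + l⁻¹ * a ^ 2 := by
  rcases le_total a l with h | h
  · exact h.trans le_self_add
  · refine le_trans ?_ le_add_self
    calc a = l⁻¹ * l * a := by rw [ENNReal.inv_mul_cancel hl hl', one_mul]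
      _ ≤ l⁻¹ * a * a := by gcongr
      _ = l⁻¹ * a ^ 2 := by ring

/-- The integral over all heights of the squared length of the horizontal slices of `S`, a second
moment that controls the area of `S`. -/
noncomputable def sliceEnergy (S : Set ℝ²) : ℝ≥0∞ := ∫⁻ h, volume (horizontalSlice S h) ^ 2

variable {J : Set ℝ}

theorem support_volume_horizontalSlice_subset (hSJ : ∀ x ∈ S, x 1 ∈ J) :
    (Function.support fun h => volume (horizontalSlice S h)) ⊆ J := by
  intro h hh
  obtain ⟨s, hs⟩ := nonempty_of_measure_ne_zero hh
  exact hSJ _ hs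

theorem sliceEnergy_eq_setLIntegral (hJ : MeasurableSet J) (hSJ : ∀ x ∈ S, x 1 ∈ J) :
    sliceEnergy S = ∫⁻ h in J, volume (horizontalSlice S h) ^ 2 := by
  rw [sliceEnergy, ← lintegral_indicator hJ, indicator_eq_self.2]
  rw [Function.support_pow _ two_ne_zero]
  exact support_volume_horizontalSlice_subset hSJ

theorem volume_le_add_inv_mul_sliceEnergy (hS : MeasurableSet S) (hJ : MeasurableSet J)
    (hJ1 : volume J ≤ 1) (hSJ : ∀ x ∈ S, x 1 ∈ J) {l : ℝ≥0∞} (hl : l ≠ 0) (hl' : l ≠ ⊤) :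
    volume S ≤ l + l⁻¹ * sliceEnergy S := by
  calc volume S = ∫⁻ h in J, volume (horizontalSlice S h) := by
        rw [volume_eq_lintegral_horizontalSlice hS, ← lintegral_indicator hJ,
          indicator_eq_self.2 (support_volume_horizontalSlice_subset hSJ)]
    _ ≤ ∫⁻ h in J, (l + l⁻¹ * volume (horizontalSlice S h) ^ 2) :=
        lintegral_mono fun h => le_add_inv_mul_sq hl hl'
    _ = l * volume J + l⁻¹ * sliceEnergy S := by
        rw [lintegral_add_left measurable_const, setLIntegral_const,
          lintegral_const_mul _ ((measurable_volume_horizontalSlice hS).pow_const 2),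
          sliceEnergy_eq_setLIntegral hJ hSJ]
    _ ≤ _ := by
        gcongr
        exact mul_le_of_le_one_right' hJ1

end Slices

section Covers

theorem exists_cover_of_hausdorffMeasure_eq_zero {X : Type*} [EMetricSpace X] [MeasurableSpace X]
    [BorelSpace X] {E : Set X} {σ : ℝ} (hσ : 0 < σ) (hE : μH[σ] E = 0) {δ : ℝ≥0∞} (hδ : 0 < δ) :
    ∃ (t : ℕ → Set X) (d : ℕ → ℝ≥0∞), E ⊆ ⋃ n, t n ∧ (∀ n, Metric.ediam (t n) ≤ d n) ∧
      (∀ n, 0 < d n) ∧ (∀ n, d n ≤ δ) ∧ ∑' n, d n ^ σ ≤ 1 := by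
  obtain ⟨ε, hε, hεsum⟩ := ENNReal.exists_pos_sum_of_countable' (ε := 2⁻¹) (by simp) ℕ
  have hlt : (⨅ (t : ℕ → Set X) (_ : E ⊆ ⋃ n, t n) (_ : ∀ n, Metric.ediam (t n) ≤ δ),
      ∑' n, ⨆ _ : (t n).Nonempty, Metric.ediam (t n) ^ σ) < 2⁻¹ := by
    refine lt_of_le_of_lt ?_ (show (0 : ℝ≥0∞) < 2⁻¹ by simp)
    rw [← hE, Measure.hausdorffMeasure_apply]
    exact le_iSup₂_of_le δ hδ le_rfl
  simp only [iInf_lt_iff] at hlt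
  obtain ⟨t, hcov, hdiam, hsum⟩ := hlt
  refine ⟨t, fun n => max (Metric.ediam (t n)) (min δ (ε n ^ σ⁻¹)), hcov, fun n => le_max_left _ _,
    fun n => lt_max_of_lt_right (lt_min hδ (ENNReal.rpow_pos_of_nonneg (hε n) (by positivity))),
    fun n => max_le (hdiam n) (min_le_left _ _), ?_⟩
  have hterm : ∀ n, max (Metric.ediam (t n)) (min δ (ε n ^ σ⁻¹)) ^ σ ≤
      (⨆ _ : (t n).Nonempty, Metric.ediam (t n) ^ σ) + ε n := by
    intro n
    rcases le_total (Metric.ediam (t n)) (min δ (ε n ^ σ⁻¹)) with h | h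
    · rw [max_eq_right h]
      calc min δ (ε n ^ σ⁻¹) ^ σ ≤ (ε n ^ σ⁻¹) ^ σ := by
            gcongr
            exact min_le_right _ _
        _ ≤ _ := by
            rw [ENNReal.rpow_inv_rpow hσ.ne']
            exact le_add_self
    · rw [max_eq_left h]
      rcases (t n).eq_empty_or_nonempty with ht | ht
      · simp [ht, hσ]
      · rw [iSup_pos ht]
        exact le_self_add
  calc ∑' n, max (Metric.ediam (t n)) (min δ (ε n ^ σ⁻¹)) ^ σ
      ≤ ∑' n, ((⨆ _ : (t n).Nonempty, Metric.ediam (t n) ^ σ) + ε n) :=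
        ENNReal.tsum_le_tsum hterm
    _ ≤ 2⁻¹ + 2⁻¹ := by
        rw [ENNReal.tsum_add]
        exact add_le_add hsum.le hεsum.le
    _ = 1 := ENNReal.inv_two_add_inv_two

theorem exists_half_pow_near {d : ℝ≥0∞} {j : ℕ} (hd : 0 < d)
    (hdj : d ≤ ENNReal.ofReal ((1 / 2) ^ j / 4)) :
    ∃ k ≥ j, d ≤ ENNReal.ofReal ((1 / 2) ^ k / 4) ∧ ENNReal.ofReal (1 / 2) ^ k ≤ 8 * d := by
  lift d to NNReal using ne_top_of_le_ne_top ENNReal.ofReal_ne_top hdj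
  have hd0 : (0 : ℝ) < d := by exact_mod_cast hd
  rw [← ENNReal.ofReal_coe_nnreal, ENNReal.ofReal_le_ofReal_iff (by positivity)] at hdj
  have hj1 : ((1 : ℝ) / 2) ^ j ≤ 1 := pow_le_one₀ (by norm_num) (by norm_num)
  obtain ⟨k, hk, hk'⟩ := exists_nat_pow_near_of_lt_one (show 0 < 4 * (d : ℝ) by positivity)
    (by linarith) (show (0 : ℝ) < 1 / 2 by norm_num) (by norm_num)
  have hjk : j < k + 1 := (pow_lt_pow_iff_right_of_lt_one₀ (by norm_num) (by norm_num)).1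
    (show ((1 : ℝ) / 2) ^ (k + 1) < (1 / 2) ^ j by linarith)
  refine ⟨k, Nat.lt_succ_iff.1 hjk, ?_, ?_⟩
  · rw [← ENNReal.ofReal_coe_nnreal]
    exact ENNReal.ofReal_le_ofReal (by linarith)
  · rw [← ENNReal.ofReal_coe_nnreal, ← ENNReal.ofReal_pow (by norm_num),
      ← ENNReal.ofReal_ofNat 8, ← ENNReal.ofReal_mul (by norm_num)]
    refine ENNReal.ofReal_le_ofReal ?_
    rw [pow_succ] at hk
    linarith

theorem tsum_subtype_le_tsum_comp_of_subset_range {α β : Type*} {T : Set β} {g : α → β}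
    (hT : T ⊆ range g) (f : β → ℝ≥0∞) : ∑' z : T, f z ≤ ∑' n, f (g n) := by
  choose n hn using fun z : T => hT z.2
  have hinj : Function.Injective n := fun z w h => Subtype.ext (by rw [← hn z, ← hn w, h])
  calc ∑' z : T, f z = ∑' z : T, f (g (n z)) := by simp only [hn]
    _ ≤ ∑' n, f (g n) := ENNReal.tsum_comp_le_tsum_of_injective hinj fun n => f (g n)

theorem exists_gridCube_cover {ι : Type*} [Fintype ι] {E : Set (EuclideanSpace ℝ ι)} {σ : ℝ}
    (hσ : 0 < σ) (hE : μH[σ] E = 0) (j : ℕ) :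
    ∃ T : Set (ℕ × (ι → ℤ)), (∀ z ∈ T, j ≤ z.1) ∧
      (∀ z ∈ T, (E ∩ gridCube ((1 / 2) ^ z.1) z.2).Nonempty) ∧
      E ⊆ ⋃ z : T, gridCube ((1 / 2) ^ z.1.1) z.1.2 ∧
      ∑' z : T, (ENNReal.ofReal (1 / 2) ^ z.1.1) ^ σ ≤ 8 ^ σ := by
  obtain ⟨t, d, hcov, hdiam, hd0, hdj, hsum⟩ := exists_cover_of_hausdorffMeasure_eq_zero hσ hE
    (ENNReal.ofReal_pos.2 (show (0 : ℝ) < (1 / 2) ^ j / 4 by positivity))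
  choose k hjk hdk hkd using fun n => exists_half_pow_near (hd0 n) (hdj n)
  choose m hm using fun n =>
    exists_subset_gridCube (r := (1 / 2) ^ k n) (by positivity) ((hdiam n).trans (hdk n))
  refine ⟨(fun n => (k n, m n)) '' {n | (E ∩ t n).Nonempty}, ?_, ?_, ?_, ?_⟩
  · rintro _ ⟨n, -, rfl⟩
    exact hjk n
  · rintro _ ⟨n, hn, rfl⟩
    exact hn.mono (inter_subset_inter_right E (hm n))
  · intro u hu
    obtain ⟨n, hn⟩ := mem_iUnion.1 (hcov hu)
    exact mem_iUnion.2 ⟨⟨(k n, m n), n, ⟨u, hu, hn⟩, rfl⟩, hm n hn⟩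
  · refine (tsum_subtype_le_tsum_comp_of_subset_range (image_subset_range _ _)
      fun z : ℕ × (ι → ℤ) => (ENNReal.ofReal (1 / 2) ^ z.1) ^ σ).trans ?_
    calc ∑' n, (ENNReal.ofReal (1 / 2) ^ k n) ^ σ ≤ ∑' n, 8 ^ σ * d n ^ σ := by
          refine ENNReal.tsum_le_tsum fun n => ?_
          rw [← ENNReal.mul_rpow_of_nonneg _ _ hσ.le]
          exact ENNReal.rpow_le_rpow (hkd n) hσ.le
      _ ≤ 8 ^ σ := by
          rw [ENNReal.tsum_mul_left]
          exact mul_le_of_le_one_right' hsum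

end Covers

section RandomCovers

theorem ae_hausdorffMeasure_eq_zero_of_tendsto {X Y : Type*} [EMetricSpace X] [MeasurableSpace X]
    [BorelSpace X] [MeasurableSpace Y] {μ : Measure Y} {β : ℕ → Type*} [∀ j, Countable (β j)]
    {U : ∀ j, β j → Set X} {S : ∀ j, β j → Set Y} {V : Y → Set X} {B : Set Y} {d : ℕ → ℝ≥0∞}
    {t : ℝ} (hS : ∀ j z, MeasurableSet (S j z)) (hd : Tendsto d atTop (𝓝 0))
    (hU : ∀ j z, Metric.ediam (U j z) ≤ d j)
    (hV : ∀ y ∈ B, ∀ j, V y ⊆ ⋃ z : {z // y ∈ S j z}, U j z)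
    (hlim : Tendsto (fun j => ∑' z, Metric.ediam (U j z) ^ t * μ (S j z)) atTop (𝓝 0)) :
    ∀ᵐ y ∂μ, y ∈ B → μH[t] (V y) = 0 := by
  let F : ℕ → Y → ℝ≥0∞ := fun j y =>
    ∑' z, (S j z).indicator (fun _ => Metric.ediam (U j z) ^ t) y
  have hmeas : ∀ j z, Measurable ((S j z).indicator fun _ => Metric.ediam (U j z) ^ t) :=
    fun j z => measurable_const.indicator (hS j z)
  have hF : ∀ j, Measurable (F j) := fun j => Measurable.tsum (hmeas j)
  have hFint : ∀ j, ∫⁻ y, F j y ∂μ = ∑' z, Metric.ediam (U j z) ^ t * μ (S j z) := by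
    intro j
    rw [lintegral_tsum fun z => (hmeas j z).aemeasurable]
    simp_rw [lintegral_indicator_const (hS j _)]
  have hzero : ∫⁻ y, liminf (fun j => F j y) atTop ∂μ = 0 := by
    refine le_antisymm ((lintegral_liminf_le hF).trans_eq ?_) zero_le
    simp_rw [hFint]
    exact hlim.liminf_eq
  rw [lintegral_eq_zero_iff (.liminf hF)] at hzero
  filter_upwards [hzero] with y hy hyB
  refine le_antisymm ?_ zero_le
  calc μH[t] (V y) ≤ liminf (fun j => ∑' z : {z // y ∈ S j z}, Metric.ediam (U j z) ^ t) atTop :=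
        Measure.hausdorffMeasure_le_liminf_tsum t (V y) d hd (fun j (z : {z // y ∈ S j z}) => U j z)
          (.of_forall fun j z => hU j z) (.of_forall (hV y hyB))
    _ = liminf (fun j => F j y) atTop := by
        simp_rw [F]
        congr 1 with j
        exact tsum_subtype {z | y ∈ S j z} fun z => Metric.ediam (U j z) ^ t
    _ = 0 := hy

variable {α : Type*} {b A K : ℝ≥0∞} {σ κ t : ℝ} {T : Set (ℕ × α)} {v Z : ℕ × α → ℝ≥0∞} {j : ℕ}

theorem rpow_mul_le_of_le_add_inv_mul {ρ a w : ℝ≥0∞} (hρ : ρ ≠ 0) (hρ' : ρ ≠ ⊤)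
    (ht : 2 * t = σ + 1 + 4 * κ) (ha : ∀ l, l ≠ 0 → l ≠ ⊤ → a ≤ l + l⁻¹ * w) :
    ρ ^ t * a ≤ ρ ^ κ * ρ ^ σ + ρ ^ (1 + 3 * κ) * w := by
  set l := ρ ^ ((σ - 1 - 2 * κ) / 2) with hl
  have hl0 : l ≠ 0 := (ENNReal.rpow_pos (pos_iff_ne_zero.2 hρ) hρ').ne'
  have hl_top : l ≠ ⊤ := ENNReal.rpow_ne_top_of_ne_zero hρ hρ'
  have hleft : ρ ^ t * l = ρ ^ κ * ρ ^ σ := by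
    rw [hl, ← ENNReal.rpow_add _ _ hρ hρ', ← ENNReal.rpow_add _ _ hρ hρ']
    congr 1
    linarith
  have hright : ρ ^ t * l⁻¹ = ρ ^ (1 + 3 * κ) := by
    rw [hl, ← ENNReal.rpow_neg, ← ENNReal.rpow_add _ _ hρ hρ']
    congr 1
    linarith
  calc ρ ^ t * a ≤ ρ ^ t * (l + l⁻¹ * w) := by
        gcongr
        exact ha l hl0 hl_top
    _ = ρ ^ κ * ρ ^ σ + ρ ^ (1 + 3 * κ) * w := by rw [mul_add, ← mul_assoc, hleft, hright]

theorem tsum_subtype_rpow_mul_le (hb : b ≠ 0) (hb1 : b < 1) (hκ : 0 ≤ κ) (hT : ∀ z ∈ T, j ≤ z.1)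
    (hZ : ∀ k ≥ j, ∀ M : Finset α, (∀ m ∈ M, (k, m) ∈ T) →
      ∑ m ∈ M, Z (k, m) ≤ K * (b ^ k) ^ (-1 - κ)) :
    ∑' z : T, (b ^ z.1.1) ^ (1 + 3 * κ) * Z z ≤ (b ^ κ) ^ j * (K * (1 - b ^ κ)⁻¹) := by
  classical
  have hρ : ∀ k, b ^ k ≠ 0 := fun k => pow_ne_zero k hb
  have hρ' : ∀ k, b ^ k ≠ ⊤ := fun k => ENNReal.pow_ne_top hb1.ne_top
  have hb1κ : b ^ κ ≤ 1 := ENNReal.rpow_le_one hb1.le hκ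
  have hlevel : ∀ k ≥ j, ∀ M : Finset α, (∀ m ∈ M, (k, m) ∈ T) →
      ∑ m ∈ M, (b ^ k) ^ (1 + 3 * κ) * Z (k, m) ≤ (b ^ κ) ^ j * K * (b ^ κ) ^ k := by
    intro k hk M hM
    calc ∑ m ∈ M, (b ^ k) ^ (1 + 3 * κ) * Z (k, m)
        ≤ (b ^ k) ^ (1 + 3 * κ) * (K * (b ^ k) ^ (-1 - κ)) := by
          rw [← Finset.mul_sum]
          gcongr
          exact hZ k hk M hM
      _ = (b ^ κ) ^ k * K * (b ^ κ) ^ k := by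
          rw [mul_left_comm, ← ENNReal.rpow_add _ _ (hρ k) (hρ' k),
            show 1 + 3 * κ + (-1 - κ) = κ + κ by ring, ENNReal.rpow_add _ _ (hρ k) (hρ' k),
            ← ENNReal.rpow_natCast b k, ← ENNReal.rpow_mul, mul_comm (k : ℝ), ENNReal.rpow_mul,
            ENNReal.rpow_natCast]
          ring
      _ ≤ (b ^ κ) ^ j * K * (b ^ κ) ^ k := by
          gcongr ?_ * K * _
          exact pow_le_pow_right_of_le_one' hb1κ hk
  rw [tsum_subtype T fun z => (b ^ z.1) ^ (1 + 3 * κ) * Z z, ENNReal.tsum_prod']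
  calc _ ≤ ∑' k, (b ^ κ) ^ j * K * (b ^ κ) ^ k := by
        refine ENNReal.tsum_le_tsum fun k => ?_
        rw [ENNReal.tsum_eq_iSup_sum]
        refine iSup_le fun M => ?_
        simp only [indicator_apply, ← Finset.sum_filter]
        by_cases hk : j ≤ k
        · exact hlevel k hk _ fun m hm => (Finset.mem_filter.1 hm).2
        · rw [Finset.filter_false_of_mem fun m _ hm => hk (hT _ hm), Finset.sum_empty]
          exact zero_le
    _ = (b ^ κ) ^ j * (K * (1 - b ^ κ)⁻¹) := by
        rw [ENNReal.tsum_mul_left, ENNReal.tsum_geometric, mul_assoc]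

theorem tsum_subtype_rpow_mul_le_of_le_add_inv_mul (hb : b ≠ 0) (hb1 : b < 1) (hκ : 0 ≤ κ)
    (ht : 2 * t = σ + 1 + 4 * κ) (hT : ∀ z ∈ T, j ≤ z.1)
    (hv : ∀ z ∈ T, ∀ l, l ≠ 0 → l ≠ ⊤ → v z ≤ l + l⁻¹ * Z z)
    (hA : ∑' z : T, (b ^ z.1.1) ^ σ ≤ A)
    (hZ : ∀ k ≥ j, ∀ M : Finset α, (∀ m ∈ M, (k, m) ∈ T) →
      ∑ m ∈ M, Z (k, m) ≤ K * (b ^ k) ^ (-1 - κ)) :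
    ∑' z : T, (b ^ z.1.1) ^ t * v z ≤ (b ^ κ) ^ j * (A + K * (1 - b ^ κ)⁻¹) := by
  have hterm : ∀ z : T, (b ^ z.1.1) ^ t * v z ≤
      (b ^ κ) ^ j * (b ^ z.1.1) ^ σ + (b ^ z.1.1) ^ (1 + 3 * κ) * Z z := by
    intro z
    have hpow : (b ^ z.1.1) ^ κ ≤ (b ^ κ) ^ j := by
      calc (b ^ z.1.1) ^ κ ≤ (b ^ j) ^ κ :=
            ENNReal.rpow_le_rpow (pow_le_pow_right_of_le_one' hb1.le (hT z z.2)) hκ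
        _ = (b ^ κ) ^ j := by
            rw [← ENNReal.rpow_natCast b, ← ENNReal.rpow_mul, mul_comm, ENNReal.rpow_mul,
              ENNReal.rpow_natCast]
    refine (rpow_mul_le_of_le_add_inv_mul (pow_ne_zero _ hb) (ENNReal.pow_ne_top hb1.ne_top) ht
      (hv z z.2)).trans ?_
    gcongr
  calc ∑' z : T, (b ^ z.1.1) ^ t * v z
      ≤ (b ^ κ) ^ j * ∑' z : T, (b ^ z.1.1) ^ σ + ∑' z : T, (b ^ z.1.1) ^ (1 + 3 * κ) * Z z := by
        rw [← ENNReal.tsum_mul_left, ← ENNReal.tsum_add]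
        exact ENNReal.tsum_le_tsum hterm
    _ ≤ (b ^ κ) ^ j * A + (b ^ κ) ^ j * (K * (1 - b ^ κ)⁻¹) := by
        gcongr
        exact tsum_subtype_rpow_mul_le hb hb1 hκ hT hZ
    _ = _ := (mul_add _ _ _).symm

end RandomCovers

section Configuration

variable {Γ E : Set ℝ²} {x₀ : ℝ²} {δ c R r σ κ t : ℝ}

theorem apply_mem_Ioo_of_mem_cube {ι : Type*} {x₀ x : EuclideanSpace ℝ ι}
    (hx : x ∈ cube x₀ δ) (i : ι) : x i ∈ Ioo (x₀ i - δ) (x₀ i + δ) := by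
  have hi := abs_sub_lt_iff.1 (hx i)
  exact ⟨by linarith, by linarith⟩

theorem toLp_mem_cube_iff {s h : ℝ} : !₂[s, h] ∈ cube x₀ δ ↔
    s ∈ Ioo (x₀ 0 - δ) (x₀ 0 + δ) ∧ h ∈ Ioo (x₀ 1 - δ) (x₀ 1 + δ) := by
  refine Fin.forall_fin_two.trans (and_congr ?_ ?_) <;>
  · rw [← Real.ball_eq_Ioo, Metric.mem_ball, Real.dist_eq]
    rfl

theorem gridCube_subset_window {x : ℝ²} {m : Fin 2 → ℤ} (hE : ∀ u ∈ E, x₀ 1 + δ + c ≤ u 1)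
    (hER : ∀ u ∈ E, ‖u‖ ≤ R) (hδ : δ ≤ 1) (hr1 : r ≤ 1) (hrc : 4 * r ≤ c)
    (hx : x ∈ cube x₀ δ) (hm : (E ∩ gridCube r m).Nonempty) :
    gridCube r m ⊆ window x (c / 2) (R + ‖x₀‖ + 3) := by
  obtain ⟨u, huE, hu⟩ := hm
  intro p hp
  have hpu : ∀ i, |p i - u i| < 2 * r := fun i => by
    linarith [abs_sub_le (p i) (gridPoint r m i) (u i), hp i, hu i,
      abs_sub_comm (u i) (gridPoint r m i)]
  have hux : ∀ i, |u i - x₀ i| ≤ R + ‖x₀‖ := fun i =>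
    (PiLp.norm_apply_le (u - x₀) i).trans
      ((norm_sub_le u x₀).trans (add_le_add_left (hER u huE) ‖x₀‖))
  have hpx : ∀ i, |p i - x i| ≤ R + ‖x₀‖ + 3 := fun i => by
    linarith [abs_sub_le (p i) (u i) (x i), abs_sub_le (u i) (x₀ i) (x i), hpu i, hux i, hx i,
      abs_sub_comm (x i) (x₀ i)]
  refine ⟨?_, (le_abs_self _).trans (hpx 1), hpx 0⟩
  linarith [hE u huE, (abs_lt.1 (hpu 1)).1, (abs_lt.1 (hx 1)).2]

theorem abs_gridPoint_le {m : Fin 2 → ℤ} (hER : ∀ u ∈ E, ‖u‖ ≤ R) (hr1 : r ≤ 1)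
    (hm : (E ∩ gridCube r m).Nonempty) (i : Fin 2) : |gridPoint r m i| ≤ R + 1 := by
  obtain ⟨u, huE, hu⟩ := hm
  have huR : |u i| ≤ R := (PiLp.norm_apply_le u i).trans (hER u huE)
  linarith [abs_sub_abs_le_abs_sub (gridPoint r m i) (u i), hu i,
    abs_sub_comm (u i) (gridPoint r m i)]

theorem ediam_gridCube_rpow_le {ι : Type*} [Fintype ι] (ht : 0 ≤ t) (k : ℕ) (m : ι → ℤ) :
    Metric.ediam (gridCube ((1 / 2) ^ k) m) ^ t ≤
      ENNReal.ofReal (2 * √(Fintype.card ι)) ^ t * (ENNReal.ofReal (1 / 2) ^ k) ^ t := by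
  rw [← ENNReal.mul_rpow_of_nonneg _ _ ht, ← ENNReal.ofReal_pow one_half_pos.le,
    ← ENNReal.ofReal_mul (by positivity)]
  exact ENNReal.rpow_le_rpow (ediam_cube_le _ (by positivity)) ht

/-- `E` is a bounded part of the continuum `Γ` lying at height at least `c` above a small cube about
`x₀` that avoids `Γ`. This is the position in which viewpoints in the cube can be compared. -/
structure LiesAboveCube (Γ E : Set ℝ²) (x₀ : ℝ²) (δ c : ℝ) : Prop where
  isClosed : IsClosed Γ
  isPreconnected : IsPreconnected Γ
  disjoint : Disjoint Γ (cube x₀ δ)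
  two_mul_le_one : 2 * δ ≤ 1
  gap_pos : 0 < c
  subset : E ⊆ Γ
  le_apply : ∀ u ∈ E, x₀ 1 + δ + c ≤ u 1
  isBounded : Bornology.IsBounded E

/-- The viewpoints in the cube about `x₀` from which some point of the grid cube `gridCube r m` may
be visible. -/
def cubeSightSet (Γ : Set ℝ²) (x₀ : ℝ²) (δ r : ℝ) (m : Fin 2 → ℤ) : Set ℝ² :=
  cube x₀ δ ∩ sightSet Γ (gridCube r m)

namespace LiesAboveCube

theorem measurableSet_cubeSightSet (H : LiesAboveCube Γ E x₀ δ c) (m : Fin 2 → ℤ) :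
    MeasurableSet (cubeSightSet Γ x₀ δ r m) :=
  ((isOpen_cube x₀ δ).inter (isOpen_sightSet H.isClosed (isOpen_cube _ r))).measurableSet

theorem exists_sum_sq_horizontalSlice_le (H : LiesAboveCube Γ E x₀ δ c) (hκ : 0 < κ)
    (hκ1 : κ ≤ 1) :
    ∃ K : ℝ≥0∞, K ≠ ⊤ ∧ ∀ {r : ℝ} {M : Finset (Fin 2 → ℤ)}, 0 < r → r ≤ 1 → 4 * r ≤ c →
      (∀ m ∈ M, (E ∩ gridCube r m).Nonempty) → ∀ h ∈ Ioo (x₀ 1 - δ) (x₀ 1 + δ),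
        ∑ m ∈ M, volume (horizontalSlice (cubeSightSet Γ x₀ δ r m) h) ^ 2 ≤
          K * ENNReal.ofReal r ^ (-1 - κ) := by
  classical
  have hδ := H.two_mul_le_one
  obtain ⟨R, hR, hER⟩ := H.isBounded.exists_pos_norm_le
  obtain ⟨C₀, hC₀, hcount⟩ :=
    exists_card_common_sight_le (half_pos H.gap_pos) (show 0 < R + ‖x₀‖ + 3 by positivity)
  set C := max C₀ ((2 * (R + 1) + 1) ^ 2)
  refine ⟨ENNReal.ofReal C * ∫⁻ u in Metric.ball (0 : ℝ) 1, ENNReal.ofReal (|u| ^ (κ - 1)),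
    ENNReal.mul_ne_top ENNReal.ofReal_ne_top (setLIntegral_ball_rpow_lt_top hκ).ne, ?_⟩
  intro r M hr hr1 hrc hM h hh
  rw [ENNReal.ofReal_rpow_of_pos hr, mul_right_comm,
    ← ENNReal.ofReal_mul (hC₀.le.trans (le_max_left _ _))]
  have hcube : ∀ s ∈ Ioo (x₀ 0 - δ) (x₀ 0 + δ), !₂[s, h] ∈ cube x₀ δ :=
    fun s hs => toLp_mem_cube_iff.2 ⟨hs, hh⟩
  have hwindow : ∀ s ∈ Ioo (x₀ 0 - δ) (x₀ 0 + δ), ∀ m ∈ M,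
      gridCube r m ⊆ window !₂[s, h] (c / 2) (R + ‖x₀‖ + 3) := fun s hs m hm =>
    gridCube_subset_window H.le_apply hER (by linarith) hr1 hrc (hcube s hs) (hM m hm)
  refine sum_volume_sq_le (a := x₀ 0 - δ) (b := x₀ 0 + δ)
    (fun m _ => measurableSet_horizontalSlice (H.measurableSet_cubeSightSet m) h)
    (fun m _ s hs => (toLp_mem_cube_iff.1 hs.1).1) (by linarith) hr hκ.le hκ1 ?_
    fun s hs s' hs' hss' => ?_
  · refine (card_le_of_abs_gridPoint_le hr hr1 (by positivity)
      fun m hm => abs_gridPoint_le hER hr1 (hM m hm)).trans ?_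
    rw [Fintype.card_fin, div_pow]
    gcongr
    exact le_max_right _ _
  · refine (hcount H.isPreconnected (x := !₂[s, h]) (y := !₂[s', h]) rfl hss'
      (show s' ≤ s + 1 by linarith [hs.1, hs'.2])
      (H.disjoint.mono_right ((convex_cube x₀ δ).segment_subset (hcube s hs) (hcube s' hs')))
      hr hr1 ?_ ?_ ?_ ?_ ?_).trans
      (div_le_div_of_nonneg_right (le_max_left _ _) (mul_pos hr (sub_pos.2 hss')).le) <;>
    intro m hm <;> obtain ⟨hmM, hms, hms'⟩ := Finset.mem_filter.1 hm
    exacts [(hM m hmM).mono (inter_subset_inter_left _ H.subset), hwindow s hs m hmM,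
      hwindow s' hs' m hmM, hms.2, hms'.2]

theorem volume_Ioo_le_one (H : LiesAboveCube Γ E x₀ δ c) :
    volume (Ioo (x₀ 1 - δ) (x₀ 1 + δ)) ≤ 1 := by
  rw [Real.volume_Ioo]
  exact ENNReal.ofReal_le_one.2 (by linarith [H.two_mul_le_one])

theorem exists_sum_sliceEnergy_le (H : LiesAboveCube Γ E x₀ δ c) (hκ : 0 < κ) (hκ1 : κ ≤ 1) :
    ∃ K : ℝ≥0∞, K ≠ ⊤ ∧ ∀ {r : ℝ} {M : Finset (Fin 2 → ℤ)}, 0 < r → r ≤ 1 → 4 * r ≤ c →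
      (∀ m ∈ M, (E ∩ gridCube r m).Nonempty) →
        ∑ m ∈ M, sliceEnergy (cubeSightSet Γ x₀ δ r m) ≤ K * ENNReal.ofReal r ^ (-1 - κ) := by
  obtain ⟨K, hK, hsum⟩ := H.exists_sum_sq_horizontalSlice_le hκ hκ1
  refine ⟨K, hK, fun {r M} hr hr1 hrc hM => ?_⟩
  calc ∑ m ∈ M, sliceEnergy (cubeSightSet Γ x₀ δ r m)
      = ∫⁻ h in Ioo (x₀ 1 - δ) (x₀ 1 + δ),
          ∑ m ∈ M, volume (horizontalSlice (cubeSightSet Γ x₀ δ r m) h) ^ 2 := by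
        rw [lintegral_finsetSum _ fun m _ => (measurable_volume_horizontalSlice
          (H.measurableSet_cubeSightSet m)).pow_const 2]
        exact Finset.sum_congr rfl fun m _ =>
          sliceEnergy_eq_setLIntegral measurableSet_Ioo fun x hx => apply_mem_Ioo_of_mem_cube hx.1 1
    _ ≤ K * ENNReal.ofReal r ^ (-1 - κ) * volume (Ioo (x₀ 1 - δ) (x₀ 1 + δ)) :=
        (setLIntegral_mono measurable_const (hsum hr hr1 hrc hM)).trans_eq (setLIntegral_const _ _)
    _ ≤ K * ENNReal.ofReal r ^ (-1 - κ) := mul_le_of_le_one_right' H.volume_Ioo_le_one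

theorem volume_cubeSightSet_le (H : LiesAboveCube Γ E x₀ δ c) (m : Fin 2 → ℤ) {l : ℝ≥0∞}
    (hl : l ≠ 0) (hl' : l ≠ ⊤) :
    volume (cubeSightSet Γ x₀ δ r m) ≤ l + l⁻¹ * sliceEnergy (cubeSightSet Γ x₀ δ r m) :=
  volume_le_add_inv_mul_sliceEnergy (H.measurableSet_cubeSightSet m) measurableSet_Ioo
    H.volume_Ioo_le_one (fun _ hx => apply_mem_Ioo_of_mem_cube hx.1 1) hl hl'

theorem exists_tsum_rpow_mul_volume_le (H : LiesAboveCube Γ E x₀ δ c) (hκ : 0 < κ) (hκ1 : κ ≤ 1)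
    (ht : 2 * t = σ + 1 + 4 * κ) {A : ℝ≥0∞} (hA : A ≠ ⊤) :
    ∃ D : ℝ≥0∞, D ≠ ⊤ ∧ ∀ {j : ℕ} {T : Set (ℕ × (Fin 2 → ℤ))}, 4 * (1 / 2) ^ j ≤ c →
      (∀ z ∈ T, j ≤ z.1) → (∀ z ∈ T, (E ∩ gridCube ((1 / 2) ^ z.1) z.2).Nonempty) →
      ∑' z : T, (ENNReal.ofReal (1 / 2) ^ z.1.1) ^ σ ≤ A →
        ∑' z : T, (ENNReal.ofReal (1 / 2) ^ z.1.1) ^ t *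
          volume (cubeSightSet Γ x₀ δ ((1 / 2) ^ z.1.1) z.1.2) ≤
            (ENNReal.ofReal (1 / 2) ^ κ) ^ j * D := by
  obtain ⟨K, hK, hsum⟩ := H.exists_sum_sliceEnergy_le hκ hκ1
  have hb0 : ENNReal.ofReal (1 / 2) ≠ 0 := (ENNReal.ofReal_pos.2 one_half_pos).ne'
  have hb1 : ENNReal.ofReal (1 / 2) < 1 := ENNReal.ofReal_lt_one.2 one_half_lt_one
  refine ⟨A + K * (1 - ENNReal.ofReal (1 / 2) ^ κ)⁻¹, ENNReal.add_ne_top.2 ⟨hA,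
    ENNReal.mul_ne_top hK (ENNReal.inv_ne_top.2 (tsub_pos_of_lt (ENNReal.rpow_lt_one hb1 hκ)).ne')⟩,
    fun {j T} hjc hjT hET hsumA => ?_⟩
  refine tsum_subtype_rpow_mul_le_of_le_add_inv_mul hb0 hb1 hκ.le ht hjT
    (v := fun z => volume (cubeSightSet Γ x₀ δ ((1 / 2) ^ z.1) z.2))
    (Z := fun z => sliceEnergy (cubeSightSet Γ x₀ δ ((1 / 2) ^ z.1) z.2))
    (fun z _ l hl hl' => H.volume_cubeSightSet_le z.2 hl hl') hsumA fun k hk M hM => ?_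
  have hkc : 4 * ((1 : ℝ) / 2) ^ k ≤ c :=
    (mul_le_mul_of_nonneg_left (pow_le_pow_of_le_one one_half_pos.le one_half_lt_one.le hk)
      zero_le_four).trans hjc
  simp only [← ENNReal.ofReal_pow one_half_pos.le]
  exact hsum (pow_pos one_half_pos k) (pow_le_one₀ one_half_pos.le one_half_lt_one.le) hkc
    fun m hm => hET (k, m) (hM m hm)

theorem exists_tsum_ediam_rpow_mul_volume_le (H : LiesAboveCube Γ E x₀ δ c) (hκ : 0 < κ)
    (hκ1 : κ ≤ 1) (ht0 : 0 ≤ t) (ht : 2 * t = σ + 1 + 4 * κ) {A : ℝ≥0∞} (hA : A ≠ ⊤) :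
    ∃ D : ℝ≥0∞, D ≠ ⊤ ∧ ∀ {j : ℕ} {T : Set (ℕ × (Fin 2 → ℤ))}, 4 * (1 / 2) ^ j ≤ c →
      (∀ z ∈ T, j ≤ z.1) → (∀ z ∈ T, (E ∩ gridCube ((1 / 2) ^ z.1) z.2).Nonempty) →
      ∑' z : T, (ENNReal.ofReal (1 / 2) ^ z.1.1) ^ σ ≤ A →
        ∑' z : T, Metric.ediam (gridCube ((1 / 2) ^ z.1.1) z.1.2) ^ t *
          volume (cubeSightSet Γ x₀ δ ((1 / 2) ^ z.1.1) z.1.2) ≤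
            (ENNReal.ofReal (1 / 2) ^ κ) ^ j * D := by
  obtain ⟨D, hD, hsum⟩ := H.exists_tsum_rpow_mul_volume_le hκ hκ1 ht hA
  set s := ENNReal.ofReal (2 * √(Fintype.card (Fin 2))) ^ t
  refine ⟨s * D, ENNReal.mul_ne_top
    (ENNReal.rpow_ne_top_of_nonneg ht0 ENNReal.ofReal_ne_top) hD, fun {j T} hjc hjT hET hsumA => ?_⟩
  calc ∑' z : T, Metric.ediam (gridCube ((1 / 2) ^ z.1.1) z.1.2) ^ t *
        volume (cubeSightSet Γ x₀ δ ((1 / 2) ^ z.1.1) z.1.2)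
      ≤ ∑' z : T, s * ((ENNReal.ofReal (1 / 2) ^ z.1.1) ^ t *
          volume (cubeSightSet Γ x₀ δ ((1 / 2) ^ z.1.1) z.1.2)) :=
        ENNReal.tsum_le_tsum fun z => by
          rw [← mul_assoc]
          gcongr
          exact ediam_gridCube_rpow_le ht0 _ _
    _ ≤ s * ((ENNReal.ofReal (1 / 2) ^ κ) ^ j * D) := by
        rw [ENNReal.tsum_mul_left]
        gcongr
        exact hsum hjc hjT hET hsumA
    _ = (ENNReal.ofReal (1 / 2) ^ κ) ^ j * (s * D) := mul_left_comm _ _ _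

theorem ae_hausdorffMeasure_visiblePart_inter_eq_zero (H : LiesAboveCube Γ E x₀ δ c) (hσ : 0 < σ)
    (hκ : 0 < κ) (hκ1 : κ ≤ 1) (ht : 2 * t = σ + 1 + 4 * κ) (hE : μH[σ] E = 0) :
    ∀ᵐ x, x ∈ cube x₀ δ → μH[t] (visiblePart Γ x ∩ E) = 0 := by
  obtain ⟨D, hD, hsum⟩ := H.exists_tsum_ediam_rpow_mul_volume_le (A := 8 ^ σ) hκ hκ1
    (by linarith) ht (ENNReal.rpow_ne_top_of_nonneg hσ.le (by simp))
  obtain ⟨k, hk⟩ := exists_pow_lt_of_lt_one (show 0 < c / 4 by linarith [H.gap_pos])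
    (one_half_lt_one (α := ℝ))
  choose T hjT hET hcov hsumT using fun j => exists_gridCube_cover hσ hE (j + k)
  have hle {i j : ℕ} (h : i ≤ j) : ((1 : ℝ) / 2) ^ j ≤ (1 / 2) ^ i :=
    pow_le_pow_of_le_one one_half_pos.le one_half_lt_one.le h
  have hb1 : ENNReal.ofReal (1 / 2) ^ κ < 1 :=
    ENNReal.rpow_lt_one (ENNReal.ofReal_lt_one.2 one_half_lt_one) hκ
  have hlim : Tendsto (fun j => (ENNReal.ofReal (1 / 2) ^ κ) ^ (j + k) * D) atTop (𝓝 0) := by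
    simpa only [zero_mul] using ENNReal.Tendsto.mul_const ((tendsto_add_atTop_iff_nat k).2
      (ENNReal.tendsto_pow_atTop_nhds_zero_of_lt_one hb1)) (Or.inr hD)
  set s := 2 * √(Fintype.card (Fin 2))
  have hr : Tendsto (fun j : ℕ => s * (1 / 2) ^ j) atTop (𝓝 0) := by
    simpa using (tendsto_pow_atTop_nhds_zero_of_lt_one one_half_pos.le
      (one_half_lt_one (α := ℝ))).const_mul s
  refine ae_hausdorffMeasure_eq_zero_of_tendsto (β := fun j => T j)
    (U := fun j z => gridCube ((1 / 2) ^ z.1.1) z.1.2)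
    (S := fun j z => cubeSightSet Γ x₀ δ ((1 / 2) ^ z.1.1) z.1.2)
    (d := fun j => ENNReal.ofReal (s * (1 / 2) ^ j))
    (fun j z => H.measurableSet_cubeSightSet _) (by simpa using ENNReal.tendsto_ofReal hr)
    (fun j z => ?_) (fun x hx j u hu => ?_)
    (tendsto_of_tendsto_of_tendsto_of_le_of_le tendsto_const_nhds hlim (fun _ => zero_le)
      fun j => hsum (by linarith [hle (Nat.le_add_left k j)]) (hjT j) (hET j) (hsumT j))
  · refine (ediam_cube_le _ (by positivity)).trans (ENNReal.ofReal_le_ofReal ?_)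
    exact mul_le_mul_of_nonneg_left (hle (le_self_add.trans (hjT j z z.2))) (by positivity)
  · obtain ⟨z, hz⟩ := mem_iUnion.1 (hcov j hu.2)
    exact mem_iUnion.2 ⟨⟨z, hx, mem_sightSet_of_mem_visiblePart hu.1 hz⟩, hz⟩

end LiesAboveCube

end Configuration

section VisibleParts

variable {Γ : Set ℝ²} {x : ℝ²} {σ κ t : ℝ}

theorem ae_cube_hausdorffMeasure_visiblePart_eq_zero (hΓ : IsClosed Γ) (hconn : IsPreconnected Γ)
    (hσ : 0 < σ) (hκ : 0 < κ) (hκ1 : κ ≤ 1) (ht : 2 * t = σ + 1 + 4 * κ) (hΓσ : μH[σ] Γ = 0)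
    {x₀ : ℝ²} {δ c : ℝ} (hδ : 2 * δ ≤ 1) (hc : 0 < c) (hdisj : Disjoint Γ (cube x₀ δ)) :
    ∀ᵐ x, x ∈ cube x₀ δ → μH[t] (visiblePart Γ x ∩ {u | x₀ 1 + δ + c ≤ u 1}) = 0 := by
  let E : ℕ → Set ℝ² := fun n => Γ ∩ {u | x₀ 1 + δ + c ≤ u 1} ∩ Metric.closedBall 0 n
  have habove : ∀ n, LiesAboveCube Γ (E n) x₀ δ c := fun n =>
    { isClosed := hΓ
      isPreconnected := hconn
      disjoint := hdisj
      two_mul_le_one := hδ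
      gap_pos := hc
      subset := fun u hu => hu.1.1
      le_apply := fun u hu => hu.1.2
      isBounded := Metric.isBounded_closedBall.subset inter_subset_right }
  have hnull : ∀ᵐ x, ∀ n, x ∈ cube x₀ δ → μH[t] (visiblePart Γ x ∩ E n) = 0 :=
    ae_all_iff.2 fun n => (habove n).ae_hausdorffMeasure_visiblePart_inter_eq_zero hσ hκ hκ1 ht
      (measure_mono_null (habove n).subset hΓσ)
  filter_upwards [hnull] with x hx hxQ
  refine measure_mono_null (fun u hu => ?_) (measure_iUnion_null fun n => hx n hxQ)
  obtain ⟨n, hn⟩ := exists_nat_ge ‖u‖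
  exact mem_iUnion.2 ⟨n, hu.1, ⟨hu.1.1, hu.2⟩, mem_closedBall_zero_iff.2 hn⟩

theorem ae_hausdorffMeasure_visiblePart_add_le_eq_zero (hΓ : IsClosed Γ)
    (hconn : IsPreconnected Γ) (hσ : 0 < σ) (hκ : 0 < κ) (hκ1 : κ ≤ 1)
    (ht : 2 * t = σ + 1 + 4 * κ) (hΓσ : μH[σ] Γ = 0) {c : ℝ} (hc : 0 < c) :
    ∀ᵐ x, x ∉ Γ → μH[t] (visiblePart Γ x ∩ {u | x 1 + c ≤ u 1}) = 0 := by
  rw [ae_iff]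
  refine measure_null_of_locally_null _ fun x₀ hx₀ => ?_
  have hx₀Γ : x₀ ∉ Γ := fun h => hx₀ fun hx => (hx h).elim
  have hsmall : ∀ᶠ δ in 𝓝[>] (0 : ℝ), δ < min (1 / 2) (c / 4) :=
    (eventually_lt_nhds (by positivity)).filter_mono nhdsWithin_le_nhds
  obtain ⟨δ, hδΓ, hδ, hδ0⟩ := ((eventually_cube_subset (hΓ.isOpen_compl.mem_nhds hx₀Γ)).and
    (hsmall.and self_mem_nhdsWithin)).exists
  obtain ⟨hδ1, hδc⟩ := lt_min_iff.1 hδ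
  refine ⟨_, inter_mem self_mem_nhdsWithin (mem_nhdsWithin_of_mem_nhds
    ((isOpen_cube x₀ δ).mem_nhds (mem_cube_self x₀ hδ0))), measure_mono_null ?_
    (ae_iff.1 (ae_cube_hausdorffMeasure_visiblePart_eq_zero hΓ hconn hσ hκ hκ1 ht hΓσ
      (by linarith) (half_pos hc) (subset_compl_iff_disjoint_left.1 hδΓ)))⟩
  rintro x ⟨hx, hxQ⟩ hnull
  refine hx fun _ => measure_mono_null (inter_subset_inter_right _ fun u hu => ?_) (hnull hxQ)
  have hx1 := (apply_mem_Ioo_of_mem_cube hxQ 1).1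
  exact le_trans (by linarith) (mem_ofPred.1 hu)

theorem ae_hausdorffMeasure_visiblePart_lt_eq_zero (hΓ : IsClosed Γ) (hconn : IsPreconnected Γ)
    (hσ : 0 < σ) (hκ : 0 < κ) (hκ1 : κ ≤ 1) (ht : 2 * t = σ + 1 + 4 * κ) (hΓσ : μH[σ] Γ = 0) :
    ∀ᵐ x, x ∉ Γ → μH[t] (visiblePart Γ x ∩ {u | x 1 < u 1}) = 0 := by
  have hgap : ∀ᵐ x, ∀ n : ℕ, x ∉ Γ →
      μH[t] (visiblePart Γ x ∩ {u | x 1 + 1 / (n + 1) ≤ u 1}) = 0 :=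
    ae_all_iff.2 fun n => ae_hausdorffMeasure_visiblePart_add_le_eq_zero hΓ hconn hσ hκ hκ1 ht hΓσ
      Nat.one_div_pos_of_nat
  filter_upwards [hgap] with x hx hxΓ
  refine measure_mono_null (fun u hu => ?_) (measure_iUnion_null fun n => hx n hxΓ)
  obtain ⟨n, hn⟩ := exists_nat_one_div_lt (sub_pos.2 (mem_ofPred.1 hu.2))
  exact mem_iUnion.2 ⟨n, hu.1, (lt_sub_iff_add_lt'.1 hn).le⟩

theorem visiblePart_image (e : ℝ² ≃ₗᵢ[ℝ] ℝ²) (Γ : Set ℝ²) (x : ℝ²) :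
    visiblePart (e '' Γ) (e x) = e '' visiblePart Γ x := by
  have hseg : ∀ u, segment ℝ (e x) (e u) = e '' segment ℝ x u := fun u =>
    (image_segment ℝ e.toLinearEquiv.toLinearMap.toAffineMap x u).symm
  ext v
  obtain ⟨u, rfl⟩ := e.surjective v
  rw [e.injective.mem_set_image]
  refine and_congr e.injective.mem_set_image ?_
  rw [hseg, ← image_inter e.injective, ← image_singleton, (image_injective.2 e.injective).eq_iff]

theorem ae_hausdorffMeasure_visiblePart_isometry_lt_eq_zero (hΓ : IsClosed Γ)
    (hconn : IsPreconnected Γ) (hσ : 0 < σ) (hκ : 0 < κ) (hκ1 : κ ≤ 1)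
    (ht : 2 * t = σ + 1 + 4 * κ) (hΓσ : μH[σ] Γ = 0) (e : ℝ² ≃ₗᵢ[ℝ] ℝ²) :
    ∀ᵐ x, x ∉ Γ → μH[t] (visiblePart Γ x ∩ {u | e x 1 < e u 1}) = 0 := by
  have himage : ∀ {d : ℝ} (A : Set ℝ²), 0 < d → μH[d] (e '' A) = μH[d] A :=
    fun A hd => e.isometry.hausdorffMeasure_image (Or.inl hd.le) A
  have hclosed : IsClosed (e '' Γ) := e.toHomeomorph.isClosed_image.2 hΓ
  have habove := ae_hausdorffMeasure_visiblePart_lt_eq_zero hclosed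
    (hconn.image e e.continuous.continuousOn) hσ hκ hκ1 ht ((himage Γ hσ).trans hΓσ)
  filter_upwards [e.measurePreserving.quasiMeasurePreserving.ae habove] with x hx hxΓ
  rw [← himage _ (by linarith : 0 < t)]
  refine measure_mono_null ?_ (hx fun hmem => hxΓ (e.injective.mem_set_image.1 hmem))
  rw [visiblePart_image]
  exact image_subset_iff.2 fun u hu => ⟨mem_image_of_mem e hu.1, hu.2⟩

theorem ae_hausdorffMeasure_visiblePart_eq_zero (hΓ : IsClosed Γ) (hconn : IsPreconnected Γ)
    (hσ : 0 < σ) (hκ : 0 < κ) (hκ1 : κ ≤ 1) (ht : 2 * t = σ + 1 + 4 * κ) (hΓσ : μH[σ] Γ = 0) :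
    ∀ᵐ x, x ∉ Γ → μH[t] (visiblePart Γ x) = 0 := by
  let swap : ℝ² ≃ₗᵢ[ℝ] ℝ² := LinearIsometryEquiv.piLpCongrLeft 2 ℝ ℝ (Equiv.swap 0 1)
  have hside := ae_hausdorffMeasure_visiblePart_isometry_lt_eq_zero hΓ hconn hσ hκ hκ1 ht hΓσ
  filter_upwards [hside (.refl ℝ _), hside (.neg ℝ), hside swap, hside (swap.trans (.neg ℝ))]
    with x above below right left hx
  refine measure_mono_null (fun u hu => ?_) (measure_union_null
    (measure_union_null (above hx) (below hx)) (measure_union_null (right hx) (left hx)))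
  have hne : u ≠ x := fun h => hx (h ▸ hu.1)
  have hcoord : u 0 ≠ x 0 ∨ u 1 ≠ x 1 := by
    by_contra! h
    exact hne (PiLp.ext (Fin.forall_fin_two.2 h))
  rcases hcoord with h | h <;> rcases h.lt_or_gt with h | h
  · exact Or.inr (Or.inr ⟨hu, neg_lt_neg h⟩)
  · exact Or.inr (Or.inl ⟨hu, h⟩)
  · exact Or.inl (Or.inr ⟨hu, neg_lt_neg h⟩)
  · exact Or.inl (Or.inl ⟨hu, h⟩)

theorem dimH_visiblePart_of_mem (hx : x ∈ Γ) : dimH (visiblePart Γ x) = 0 := by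
  have hsub : visiblePart Γ x ⊆ {x} := by
    rintro u ⟨-, hu⟩
    have hmem : x ∈ segment ℝ x u ∩ Γ := ⟨left_mem_segment ℝ x u, hx⟩
    rw [hu] at hmem
    exact hmem.symm
  exact (subsingleton_singleton.anti hsub).dimH_zero

end VisibleParts

theorem hausdorffMeasure_eq_zero_of_toReal_dimH_lt {X : Type*} [EMetricSpace X]
    [MeasurableSpace X] [BorelSpace X] {A : Set X} {d : ℝ} (hA : dimH A ≠ ⊤)
    (hd : (dimH A).toReal < d) : μH[d] A = 0 := by
  lift d to NNReal using ENNReal.toReal_nonneg.trans hd.le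
  exact hausdorffMeasure_of_dimH_lt ((ENNReal.lt_ofReal_iff_toReal_lt hA).2 hd |>.trans_eq
    (ENNReal.ofReal_coe_nnreal))

theorem dimH_le_of_forall_hausdorffMeasure_eq_zero {X : Type*} [EMetricSpace X]
    [MeasurableSpace X] [BorelSpace X] {A : Set X} {d : ℝ} {ι : Type*} {l : Filter ι} [l.NeBot]
    {t : ι → ℝ} (ht : Tendsto t l (𝓝 d)) (ht0 : ∀ i, 0 ≤ t i) (hA : ∀ i, μH[t i] A = 0) :
    dimH A ≤ ENNReal.ofReal d := by
  refine ge_of_tendsto' (ENNReal.tendsto_ofReal ht) fun i => ?_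
  refine dimH_le_of_hausdorffMeasure_ne_top (d := (t i).toNNReal) ?_
  rw [Real.coe_toNNReal _ (ht0 i), hA i]
  exact ENNReal.zero_ne_top

theorem dimH_le_finrank {V : Type*} [NormedAddCommGroup V] [NormedSpace ℝ V]
    [FiniteDimensional ℝ V] (A : Set V) : dimH A ≤ Module.finrank ℝ V :=
  (dimH_mono (subset_univ A)).trans_eq (Real.dimH_univ_eq_finrank V)

theorem half_dimH_add_one_le {Γ : Set ℝ²} (h : 1 ≤ dimH Γ) :
    (dimH Γ + 1) / 2 ≤ ENNReal.ofReal (1 / 2 + √((dimH Γ).toReal - 3 / 4)) := by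
  have h2 : dimH Γ ≤ 2 := by simpa using dimH_le_finrank Γ
  lift dimH Γ to NNReal using ne_top_of_le_ne_top ENNReal.ofNat_ne_top h2 with s
  norm_cast at h h2
  have hs : (1 : ℝ) ≤ s := h
  have hs2 : (s : ℝ) ≤ 2 := h2
  have hsqrt : (s : ℝ) / 2 ≤ √(s - 3 / 4) := Real.le_sqrt_of_sq_le (by nlinarith [hs, hs2])
  refine le_trans ?_ (ENNReal.ofReal_le_ofReal (show ((s : ℝ) + 1) / 2 ≤ _ by
    rw [ENNReal.coe_toReal]
    linarith))
  rw [ENNReal.ofReal_div_of_pos two_pos]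
  norm_num [ENNReal.ofReal_add]

theorem theorem1_general {Γ : Set ℝ²} (hΓ : IsClosed Γ) (hconn : IsPreconnected Γ) :
    ∀ᵐ x, dimH (visiblePart Γ x) ≤ (dimH Γ + 1) / 2 := by
  have hfin : dimH Γ ≠ ⊤ := ne_top_of_le_ne_top (ENNReal.natCast_ne_top _) (dimH_le_finrank Γ)
  set s := (dimH Γ).toReal
  have hs0 : 0 ≤ s := ENNReal.toReal_nonneg
  let κ : ℕ → ℝ := fun n => 1 / (n + 1)
  have hκ : ∀ n, 0 < κ n := fun n => Nat.one_div_pos_of_nat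
  have hκ1 : ∀ n, κ n ≤ 1 := fun n => Nat.one_div_le_one_div n.zero_le |>.trans_eq (by simp)
  have hlim : Tendsto (fun n => (s + 1) / 2 + 5 / 2 * κ n) atTop (𝓝 ((s + 1) / 2)) := by
    simpa [κ] using
      (tendsto_one_div_add_atTop_nhds_zero_nat.const_mul (5 / 2)).const_add ((s + 1) / 2)
  have hnull : ∀ᵐ x, ∀ n, x ∉ Γ → μH[(s + 1) / 2 + 5 / 2 * κ n] (visiblePart Γ x) = 0 :=
    ae_all_iff.2 fun n => ae_hausdorffMeasure_visiblePart_eq_zero (σ := s + κ n) hΓ hconn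
      (by linarith [hκ n]) (hκ n) (hκ1 n) (by ring)
      (hausdorffMeasure_eq_zero_of_toReal_dimH_lt hfin (lt_add_of_pos_right s (hκ n)))
  filter_upwards [hnull] with x hx
  by_cases hxΓ : x ∈ Γ
  · rw [dimH_visiblePart_of_mem hxΓ]
    exact zero_le
  · have hdim := dimH_le_of_forall_hausdorffMeasure_eq_zero hlim
      (fun n => by linarith [hκ n]) fun n => hx n hxΓ
    rwa [ENNReal.ofReal_div_of_pos two_pos, ENNReal.ofReal_add hs0 zero_le_one,
      ENNReal.ofReal_toReal hfin, ENNReal.ofReal_one, ENNReal.ofReal_ofNat] at hdim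

theorem theorem1 (Γ : Set (EuclideanSpace ℝ (Fin 2))) (hcompact : IsCompact Γ)
    (hconn : IsConnected Γ) (hdim : 1 < dimH Γ) :
    ∀ᵐ x ∂(MeasureTheory.volume : MeasureTheory.Measure (EuclideanSpace ℝ (Fin 2))),
      dimH (visiblePart Γ x) ≤ ENNReal.ofReal (1 / 2 + Real.sqrt ((dimH Γ).toReal - 3 / 4)) :=
  (theorem1_general hcompact.isClosed hconn.isPreconnected).mono fun _ hx =>
    hx.trans (half_dimH_add_one_le hdim.le)
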